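/- Let $\Phi$ be a finite reduced crystallographic root system spanning a real vector space $V$ (for example the root system of a finite dimensional complex semisimple Lie algebra $\mathfrak g$ with respect to a Cartan subalgebra $\mathfrak h$, with $V=\mathbb R\Phi$), let $\{\alpha_i \mid i\in I\}$ be a set of simple roots, and let $W$ be the Weyl group, generated by the simple reflections $s_i:V\to V$. Let $(-,-)$ be the $W$-invariant inner product on $V$ with $(\alpha,\alpha)=2$ for all short roots $\alpha$ in each component of $\Phi$. For $J\subset I$ let $W_J\subset W$ be the subgroup generated by $\{s_i\mid i\in J\}$ and let $w_J$ be its longest element. Let $(X,\tau)$ be a Satake diagram: $X\subset I$, and $\tau:I\to I$ is an automorphism of the Dynkin diagram with $\tau(X)=X$ and $\tau^2=\mathrm{id}_I$, such that $-w_X(\alpha_i)=\alpha_{\tau(i)}$ for all $i\in X$, and $\alpha_j(\rho_X^\vee)\in\mathbb Z$ for all $j\in I\setminus X$ with $\tau(j)=j$, where $\rho_X^\vee$ is half the sum of the positive coroots of the root subsystem with simple roots $\{\alpha_i\mid i\in X\}$. Extend $\tau$ linearly to $V$ by $\tau(\alpha_i)=\alpha_{\tau(i)}$ and set $\Theta=-w_X\circ\tau:V\to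 V$. Let $V_{-1}=\{v\in V\mid \Theta(v)=-v\}$ and $\widetilde\beta=\tfrac12(\beta-\Theta(\beta))$ for $\beta\in V$. Let $\theta$ be the linear map on the coroot space with dual map $\Theta$, and let $\mathfrak a=\{h\mid\theta(h)=-h\}$. Let $\Sigma$ be the set of restricted roots, i.e. of nonzero restrictions of the roots in $\Phi$ to $\mathfrak a$, where $V_{-1}$ is identified with a space of linear functionals on $\mathfrak a$ by restriction; thus $\Sigma=\{\widetilde\beta\mid\beta\in\Phi,\ \widetilde\beta\neq0\}\subset V_{-1}$. For $i\in I\setminus X$ put $\widetilde s_i=w_{\{i,\tau(i)\}\cup X}\,w_X^{-1}\in W$, and let $\widetilde W\subset W$ be the subgroup generated by all $\widetilde s_i$, $i\in I\setminus X$. Then: 1. The reflections of $V_{-1}$ at the hyperplanes perpendicular (with respect to $(-,-)$) to the elements of $\Sigma$ generate a finite reflection group $W(\Sigma)$. 2. There is an isomorphism of groups $\rho:\widetilde W\to W(\Sigma)$, given by restricting the action of $\widetilde W$ on $V$ to $V_{-1}$ (so that this action is faithful), which for every $i\in I\setminus X$ sends $\widetilde s_i$ to the reflection at the hyperplane orthogonal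 to $\widetilde\alpha_i$; in particular $\widetilde\alpha_i\in\Sigma$. -/

import Mathlib

noncomputable section

namespace RestrictedWeyl

open Module

variable {ι V N : Type*} [AddCommGroup V] [Module ℝ V] [AddCommGroup N] [Module ℝ N]

section Form

variable (P : RootPairing ι ℝ V N)

/-- Two roots lie in the same irreducible component of the root system: they are joined by a chain
of roots in which consecutive members are not orthogonal. -/
def SameComponent (i j : ι) : Prop :=
  Relation.EqvGen (fun k l ↦ P.pairing k l ≠ 0) i j

lemma sameComponent_reflectionPerm (i j : ι) : SameComponent P j (P.reflectionPerm i j) := by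
  by_cases h : P.pairing j i = 0
  · have : P.reflectionPerm i j = j := by
      apply P.root.injective
      rw [P.root_reflectionPerm, P.reflection_apply_root, h, zero_smul, sub_zero]
    rw [this]
    exact .refl _
  · refine .trans _ i _ (.rel _ _ h) (.symm _ _ (.rel _ _ ?_))
    rw [← P.pairing_reflectionPerm, P.pairing_reflectionPerm_self_right]
    simpa using h

variable [Fintype ι]

/-- The smallest value of `∑ₖ ⟨β, βₖ^∨⟩²` as `β` runs over the roots in the component of the root
with index `i`. It is attained at the short roots of that component. -/
def minRootForm (i : ι) : ℝ :=
  ⨅ j : {j : ι // SameComponent P i j}, P.RootForm (P.root j) (P.root j)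

/-- The Weyl group invariant inner product `(-,-)` on `V` for which `(α, α) = 2` for all short
roots `α` in each component: the canonical form `∑ₖ ⟨x, βₖ^∨⟩ ⟨y, βₖ^∨⟩`, rescaled on each
component. See `normForm_symm`, `normForm_reflection`, `normForm_pos` and `normForm_short`. -/
def normForm : LinearMap.BilinForm ℝ V :=
  ∑ k, (2 / minRootForm P k) • (P.coroot' k).smulRight (P.coroot' k)

lemma normForm_apply (x y : V) : normForm P x y =
    ∑ k, 2 / minRootForm P k * (P.coroot' k x * P.coroot' k y) := by
  simp [normForm]

lemma normForm_symm (x y : V) : normForm P x y = normForm P y x := by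
  simp only [normForm_apply]
  exact Finset.sum_congr rfl fun k _ ↦ by ring

lemma minRootForm_congr {i j : ι} (h : SameComponent P i j) :
    minRootForm P i = minRootForm P j := by
  have : SameComponent P i = SameComponent P j := by
    funext k
    exact propext ⟨fun hk ↦ .trans _ _ _ (.symm _ _ h) hk, fun hk ↦ .trans _ _ _ h hk⟩
  unfold minRootForm
  rw [this]

lemma rootForm_root_pos (i : ι) : 0 < P.RootForm (P.root i) (P.root i) := by
  rw [P.rootForm_apply_apply]
  refine Finset.sum_pos' (fun k _ ↦ mul_self_nonneg _) ⟨i, Finset.mem_univ _, ?_⟩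
  simp

lemma minRootForm_exists (i : ι) : ∃ j, SameComponent P i j ∧
    minRootForm P i = P.RootForm (P.root j) (P.root j) := by
  have : Nonempty {j : ι // SameComponent P i j} := ⟨⟨i, .refl _⟩⟩
  obtain ⟨j, hj⟩ := exists_eq_ciInf_of_finite
    (f := fun j : {j : ι // SameComponent P i j} ↦ P.RootForm (P.root j) (P.root j))
  exact ⟨j, j.2, hj.symm⟩

lemma minRootForm_le {i j : ι} (h : SameComponent P i j) :
    minRootForm P i ≤ P.RootForm (P.root j) (P.root j) :=
  ciInf_le (f := fun j : {j : ι // SameComponent P i j} ↦ P.RootForm (P.root j) (P.root j))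
    (Set.finite_range _).bddBelow ⟨j, h⟩

lemma minRootForm_pos (i : ι) : 0 < minRootForm P i := by
  obtain ⟨j, -, hj⟩ := minRootForm_exists P i
  exact hj ▸ rootForm_root_pos P j

/-- The form is invariant under the Weyl group. -/
lemma normForm_reflection (i : ι) (x y : V) :
    normForm P (P.reflection i x) (P.reflection i y) = normForm P x y := by
  simp only [normForm_apply]
  refine Fintype.sum_equiv (P.reflectionPerm i) _ _ fun k ↦ ?_
  rw [P.coroot'_reflectionPerm, minRootForm_congr P (sameComponent_reflectionPerm P i k)]
  simp

/-- The form is positive definite. -/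
lemma normForm_pos [P.IsRootSystem] {x : V} (hx : x ≠ 0) : 0 < normForm P x x := by
  rw [normForm_apply]
  have hnn : ∀ k ∈ Finset.univ, 0 ≤ 2 / minRootForm P k * (P.coroot' k x * P.coroot' k x) :=
    fun k _ ↦ mul_nonneg (div_pos two_pos (minRootForm_pos P k)).le (mul_self_nonneg _)
  refine (Finset.sum_nonneg hnn).lt_of_ne fun h0 ↦ hx ?_
  have h1 := (Finset.sum_eq_zero_iff_of_nonneg hnn).1 h0.symm
  have h2 : ∀ k, P.coroot' k x = 0 := fun k ↦ by
    have := h1 k (Finset.mem_univ _)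
    rcases mul_eq_zero.1 this with h | h
    · exact absurd h (div_pos two_pos (minRootForm_pos P k)).ne'
    · simpa using h
  have h3 : P.toLinearMap x = 0 := by
    refine LinearMap.ext_on (RootPairing.IsRootSystem.span_coroot_eq_top (P := P)) ?_
    rintro _ ⟨k, rfl⟩
    exact h2 k
  exact P.toPerfPair.injective (h3.trans (map_zero P.toPerfPair).symm)

lemma normForm_root (i : ι) : normForm P (P.root i) (P.root i) =
    2 / minRootForm P i * P.RootForm (P.root i) (P.root i) := by
  rw [normForm_apply, P.rootForm_apply_apply, Finset.mul_sum]
  refine Finset.sum_congr rfl fun k _ ↦ ?_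
  by_cases h : P.pairing i k = 0
  · simp [h]
  · rw [minRootForm_congr P (.rel _ _ h : SameComponent P i k)]

/-- Short roots, i.e. the shortest roots of each component, have squared length `2`. -/
lemma normForm_short (i : ι) (h : ∀ j, SameComponent P i j →
    normForm P (P.root i) (P.root i) ≤ normForm P (P.root j) (P.root j)) :
    normForm P (P.root i) (P.root i) = 2 := by
  obtain ⟨j, hj, hm⟩ := minRootForm_exists P i
  have hpos := minRootForm_pos P i
  have h1 := h j hj
  rw [normForm_root, normForm_root, ← minRootForm_congr P hj, ← hm,
    div_mul_cancel₀ _ hpos.ne'] at h1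
  rw [normForm_root]
  refine le_antisymm h1 ?_
  have := minRootForm_le P (.refl i : SameComponent P i i)
  rw [div_mul_eq_mul_div, le_div_iff₀ hpos]
  linarith

/-- The orthogonal reflection `v ↦ v - 2 (v, γ) / (γ, γ) γ` of a subspace `U` of `V` at the
hyperplane of `U` orthogonal to a nonzero vector `γ ∈ U`. -/
def orthReflection (U : Submodule ℝ V) (γ : U) : U ≃ₗ[ℝ] U :=
  LinearEquiv.ofInvolutive
    { toFun := fun v ↦ v - (2 * normForm P v γ / normForm P γ γ) • γ
      map_add' := fun v w ↦ by
        simp only [Submodule.coe_add, map_add, LinearMap.add_apply]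
        rw [mul_add, add_div, add_smul]
        abel
      map_smul' := fun c v ↦ by
        simp only [Submodule.coe_smul, map_smul, LinearMap.smul_apply, smul_eq_mul,
          RingHom.id_apply]
        rw [smul_sub, smul_smul]
        congr 2
        ring }
    (fun v ↦ by
      by_cases h : normForm P (γ : V) γ = 0
      · simp [h]
      · apply Subtype.ext
        change ((v : V) - (2 * normForm P (v : V) γ / normForm P (γ : V) γ) • (γ : V)) -
          (2 * normForm P ((v : V) - (2 * normForm P (v : V) γ / normForm P (γ : V) γ) • (γ : V)) γ
            / normForm P (γ : V) γ) • (γ : V) = v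
        rw [map_sub, map_smul, LinearMap.sub_apply, LinearMap.smul_apply, smul_eq_mul, sub_sub,
          ← add_smul]
        have : 2 * normForm P (v : V) γ / normForm P (γ : V) γ +
            2 * (normForm P (v : V) γ -
              2 * normForm P (v : V) γ / normForm P (γ : V) γ * normForm P (γ : V) γ) /
              normForm P (γ : V) γ = 0 := by
          field_simp
          ring
        rw [this, zero_smul, sub_zero])

lemma orthReflection_apply (U : Submodule ℝ V) (γ v : U) :
    orthReflection P U γ v = v - (2 * normForm P (v : V) γ / normForm P (γ : V) γ) • γ :=
  rfl

end Form

section Weyl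

variable {P : RootPairing ι ℝ V N} (b : P.Base)

/-- The parabolic subgroup `W_J` of the Weyl group, generated by the simple reflections `s_i` with
`i ∈ J`, as a group of linear automorphisms of `V`. -/
def parabolic (J : Set b.support) : Subgroup (V ≃ₗ[ℝ] V) :=
  Subgroup.closure ((fun i : b.support ↦ P.reflection i) '' J)

lemma parabolic_mono {J K : Set b.support} (h : J ⊆ K) : parabolic b J ≤ parabolic b K :=
  Subgroup.closure_mono (Set.image_mono h)

/-- The Weyl group `W`, generated by all simple reflections. -/
def weylGroup : Subgroup (V ≃ₗ[ℝ] V) :=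
  parabolic b Set.univ

/-- The length `l(w)` of an element of the Weyl group: the least number of factors in an expression
of `w` as a product of simple reflections. -/
def length (w : V ≃ₗ[ℝ] V) : ℕ :=
  sInf {n | ∃ l : List b.support, l.length = n ∧
    (l.map fun i : b.support ↦ P.reflection i).prod = w}

lemma finite_parabolic [Finite ι] [P.IsRootSystem] (J : Set b.support) :
    Finite (parabolic b J) := by
  have key : ∀ g : parabolic b J, ∀ k, ∃ k', (g : V ≃ₗ[ℝ] V) (P.root k) = P.root k' := by
    rintro ⟨g, hg⟩
    induction hg using Subgroup.closure_induction'' with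
    | one => exact fun k ↦ ⟨k, rfl⟩
    | mem x hx =>
      obtain ⟨i, -, rfl⟩ := hx
      exact fun k ↦ ⟨P.reflectionPerm i k, (P.root_reflectionPerm i k).symm⟩
    | inv_mem x hx =>
      obtain ⟨i, -, rfl⟩ := hx
      intro k
      refine ⟨P.reflectionPerm i k, ?_⟩
      simp only [RootPairing.reflection_inv]
      exact (P.root_reflectionPerm i k).symm
    | mul x y hx hy hx' hy' =>
      intro k
      obtain ⟨k', hk'⟩ := hy' k
      obtain ⟨k'', hk''⟩ := hx' k'
      exact ⟨k'', by simpa [hk'] using hk''⟩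
  choose f hf using key
  refine Finite.of_injective f fun g h hgh ↦ ?_
  apply Subtype.ext
  apply LinearEquiv.toLinearMap_injective
  refine LinearMap.ext_on (RootPairing.IsRootSystem.span_root_eq_top (P := P)) ?_
  rintro _ ⟨k, rfl⟩
  simp [hf, hgh]

/-- `w` is an element of maximal length of the parabolic subgroup `W_J`. -/
def IsLongest (J : Set b.support) (w : V ≃ₗ[ℝ] V) : Prop :=
  w ∈ parabolic b J ∧ ∀ v ∈ parabolic b J, length b v ≤ length b w

lemma exists_isLongest [Finite ι] [P.IsRootSystem] (J : Set b.support) :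
    ∃ w, IsLongest b J w := by
  have := finite_parabolic b J
  obtain ⟨w, hw⟩ := Finite.exists_max fun w : parabolic b J ↦ length b (w : V ≃ₗ[ℝ] V)
  exact ⟨w, w.2, fun v hv ↦ hw ⟨v, hv⟩⟩

/-- The linear automorphism of `V` induced by a permutation `τ` of the set of simple roots. -/
def permAut [P.IsRootSystem] (τ : Equiv.Perm b.support) : V ≃ₗ[ℝ] V :=
  b.toWeightBasis.equiv b.toWeightBasis τ

lemma permAut_root [P.IsRootSystem] (τ : Equiv.Perm b.support) (i : b.support) :
    permAut b τ (P.root i) = P.root (τ i) := by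
  rw [← b.toWeightBasis_apply, ← b.toWeightBasis_apply, permAut, Basis.equiv_apply]

variable [Finite ι] [P.IsRootSystem]

/-- The longest element `w_J` of the parabolic subgroup `W_J`. -/
def longest (J : Set b.support) : V ≃ₗ[ℝ] V :=
  (exists_isLongest b J).choose

lemma isLongest_longest (J : Set b.support) : IsLongest b J (longest b J) :=
  (exists_isLongest b J).choose_spec

/-- `ρ_X^∨`: half the sum of the positive coroots of the root subsystem with simple roots `α_i`,
`i ∈ X`. A root is a positive root of this subsystem if it is a sum of such simple roots. -/
def rhoCheck (X : Set b.support) : N :=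
  (1 / 2 : ℝ) • ∑ᶠ k ∈ {k : ι | P.root k ∈
    AddSubmonoid.closure ((fun i : b.support ↦ P.root i) '' X)}, P.coroot k

/-- `(X, τ)` is a Satake diagram. -/
structure IsSatakeDiagram [P.IsCrystallographic] (X : Set b.support)
    (τ : Equiv.Perm b.support) : Prop where
  /-- `τ` is an automorphism of the Dynkin diagram -/
  diagram : ∀ i j, b.cartanMatrix (τ i) (τ j) = b.cartanMatrix i j
  image_eq : τ '' X = X
  involutive : ∀ i, τ (τ i) = i
  neg_longest : ∀ i ∈ X, -(longest b X (P.root i)) = P.root (τ i)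
  integral : ∀ j, j ∉ X → τ j = j → ∃ n : ℤ, P.toLinearMap (P.root j) (rhoCheck b X) = n

variable (X : Set b.support) (τ : Equiv.Perm b.support)

/-- The map `Θ = -w_X ∘ τ` on `V`. -/
def Theta : V →ₗ[ℝ] V :=
  -((longest b X).toLinearMap ∘ₗ (permAut b τ).toLinearMap)

/-- The subspace `V₋₁` of `V`, the `(-1)`-eigenspace of `Θ`. -/
def Vneg : Submodule ℝ V :=
  LinearMap.ker (Theta b X τ + LinearMap.id)

lemma mem_Vneg {v : V} : v ∈ Vneg b X τ ↔ Theta b X τ v = -v := by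
  simp [Vneg, eq_neg_iff_add_eq_zero]

/-- The subspace `𝔞 = {h | θ(h) = -h}` of the coroot space, where `θ` is the map whose dual is
`Θ`, that is, `⟨α, θ(h)⟩ = ⟨Θ(α), h⟩` for all `α ∈ V`. -/
def aSpace : Submodule ℝ N where
  carrier := {h | ∀ α : V, P.toLinearMap (Theta b X τ α) h = -P.toLinearMap α h}
  add_mem' := fun {x y} hx hy α ↦ by
    rw [map_add, map_add, hx α, hy α, neg_add]
  zero_mem' := fun α ↦ by simp
  smul_mem' := fun c x hx α ↦ by
    rw [map_smul, map_smul, hx α, smul_neg]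

/-- The restricted roots `Σ`: the nonzero restrictions of roots to `𝔞`, viewed as elements of
`V₋₁`, which is identified with a space of linear functionals on `𝔞` by restriction. -/
def restrictedRoots : Set V :=
  {γ | γ ∈ Vneg b X τ ∧ γ ≠ 0 ∧
    ∃ k : ι, ∀ h ∈ aSpace b X τ, P.toLinearMap γ h = P.toLinearMap (P.root k) h}

/-- The vector `(β - Θ(β)) / 2`. -/
def tilde (β : V) : V :=
  (1 / 2 : ℝ) • (β - Theta b X τ β)

lemma tilde_mem_Vneg (hΘ : ∀ v, Theta b X τ (Theta b X τ v) = v) (β : V) :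
    tilde b X τ β ∈ Vneg b X τ := by
  rw [mem_Vneg, tilde, map_smul, map_sub, hΘ, ← smul_neg, neg_sub]

lemma tilde_apply {h : N} (hh : h ∈ aSpace b X τ) (β : V) :
    P.toLinearMap (tilde b X τ β) h = P.toLinearMap β h := by
  have := hh β
  rw [tilde, map_smul, map_sub, LinearMap.smul_apply, LinearMap.sub_apply, this, smul_eq_mul]
  ring

/-- Elements of `V₋₁` are determined by their restrictions to `𝔞`. -/
lemma eq_of_eqOn_aSpace (hΘ : ∀ v, Theta b X τ (Theta b X τ v) = v) {γ δ : V}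
    (hγ : γ ∈ Vneg b X τ) (hδ : δ ∈ Vneg b X τ)
    (h : ∀ x ∈ aSpace b X τ, P.toLinearMap γ x = P.toLinearMap δ x) : γ = δ := by
  have hev : ∀ y : N, P.toLinearMap γ y = P.toLinearMap δ y := by
    intro y
    obtain ⟨z, hz⟩ := P.flip.toPerfPair.surjective (P.toLinearMap.flip y ∘ₗ Theta b X τ)
    have hz' : ∀ α : V, P.toLinearMap α z = P.toLinearMap (Theta b X τ α) y := fun α ↦
      congrArg (fun f : Module.Dual ℝ V ↦ f α) hz
    have hmem : y - z ∈ aSpace b X τ := by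
      intro α
      rw [map_sub, map_sub, hz', hz', hΘ]
      ring
    have h1 := h _ hmem
    rw [map_sub, map_sub, hz', hz', (mem_Vneg b X τ).1 hγ, (mem_Vneg b X τ).1 hδ, map_neg, map_neg,
      LinearMap.neg_apply, LinearMap.neg_apply] at h1
    linarith
  apply P.toPerfPair.injective
  exact LinearMap.ext hev

/-- The restricted roots are the nonzero vectors `(β - Θ(β)) / 2`, for `β` a root. -/
lemma mem_restrictedRoots_iff (hΘ : ∀ v, Theta b X τ (Theta b X τ v) = v) {γ : V} :
    γ ∈ restrictedRoots b X τ ↔ γ ≠ 0 ∧ ∃ k, γ = tilde b X τ (P.root k) := by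
  constructor
  · rintro ⟨h1, h2, k, hk⟩
    exact ⟨h2, k, eq_of_eqOn_aSpace b X τ hΘ h1 (tilde_mem_Vneg b X τ hΘ _)
      fun x hx ↦ by rw [hk x hx, tilde_apply b X τ hx]⟩
  · rintro ⟨h2, k, rfl⟩
    exact ⟨tilde_mem_Vneg b X τ hΘ _, h2, k, fun x hx ↦ tilde_apply b X τ hx _⟩

/-- `s̃_i = w_{{i, τ(i)} ∪ X} w_X⁻¹`. -/
def sTilde (i : b.support) : V ≃ₗ[ℝ] V :=
  longest b ({i, τ i} ∪ X) * (longest b X)⁻¹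

/-- The subgroup `W̃` generated by the `s̃_i` with `i ∉ X`. -/
def WTilde : Subgroup (V ≃ₗ[ℝ] V) :=
  Subgroup.closure (sTilde b X τ '' Xᶜ)

lemma sTilde_mem_WTilde {i : b.support} (hi : i ∉ X) : sTilde b X τ i ∈ WTilde b X τ :=
  Subgroup.subset_closure ⟨i, hi, rfl⟩

/-- `W̃` is a subgroup of the Weyl group. -/
lemma WTilde_le_weylGroup : WTilde b X τ ≤ weylGroup b := by
  rw [WTilde, Subgroup.closure_le]
  rintro _ ⟨i, -, rfl⟩
  exact mul_mem (parabolic_mono b (Set.subset_univ _) (isLongest_longest b _).1)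
    (inv_mem (parabolic_mono b (Set.subset_univ _) (isLongest_longest b _).1))

end Weyl

section Restricted

variable [Fintype ι] {P : RootPairing ι ℝ V N} [P.IsRootSystem] (b : P.Base)
  (X : Set b.support) (τ : Equiv.Perm b.support)

/-- The reflection of `V₋₁` at the hyperplane orthogonal to the restricted root `γ`. -/
def restrictedReflection (γ : restrictedRoots b X τ) : Vneg b X τ ≃ₗ[ℝ] Vneg b X τ :=
  orthReflection P (Vneg b X τ) ⟨γ, γ.2.1⟩

/-- The group `W(Σ)` generated by the reflections at the hyperplanes of `V₋₁` orthogonal to the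
elements of `Σ`. -/
def restrictedWeylGroup : Subgroup (Vneg b X τ ≃ₗ[ℝ] Vneg b X τ) :=
  Subgroup.closure (Set.range (restrictedReflection b X τ))

end Restricted

end RestrictedWeyl

end

/-!
The proof uses only the combinatorics of roots and coordinates with respect to the simple roots; it
does not use the classification of Satake diagrams.

*Normality.* The map `Θ = -w_X τ` is an involutive automorphism of the root system whose fixed roots
are exactly the roots in the span of `X`. The integrality of `α_j(ρ_X^∨)` implies that `α + Θ α` is
never a root (`IsSatakeDiagram.root_add_theta_ne`): such a root would be fixed by `Θ`, so by descent
with the `s_j`, `j ∈ X`, one may take it to be a simple root, and pairing with `ρ_X^∨` gives a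
parity contradiction.

*Reflections.* Put `σ = -Θ` and let `α` be a root with `α̃ ≠ 0`. By normality, either `σ α = α`, or
`α` and `σ α` are orthogonal, or `2 α̃ = α + σ α` is a root. In each case the reflection of `V₋₁` at
`α̃` is the restriction of a product of reflections at roots in the span of `α` and `σ α`, and this
product commutes with `Θ` (`IsSatakeDiagram.exists_reflAt`). For `α = α_i`, comparing the signs of
the images of the roots in the span of `K = {i, τ i} ∪ X` shows that this element and `w_K` differ
by an element of `W_X`, which acts trivially on `V₋₁` (`IsSatakeDiagram.exists_sTilde_eq`). Hence
`s̃_i` commutes with `Θ` and acts on `V₋₁` as the reflection at `α̃_i`.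

*Generation and faithfulness.* A descent on the sum of the coefficients outside `X` shows that every
reflection at a restricted root comes from `W̃` (`IsSatakeDiagram.exists_WTilde_reflAt`). An element
of `W̃` preserves the positive roots in the span of `X`; if it acts trivially on `V₋₁`, it also sends
the simple roots outside `X` to positive roots, so it is the identity
(`IsSatakeDiagram.eq_one_of_WTilde`). Thus restriction to `V₋₁` is an isomorphism from `W̃`, a
subgroup of the finite group `W`, onto `W(Σ)`.

The facts on Weyl groups used here are the exchange condition `exchange`, its consequences
`eq_one_of_isNonneg`, `longest_apply_simple` and `mem_parabolic_of_isNonneg`, and the invariance of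
the normalised form under automorphisms of the root system, `normForm_of_permutes_roots`.
-/

namespace RestrictedWeyl

open Module

/-! ### Coordinates with respect to the simple roots -/

section Coordinates

variable {ι V N : Type*} [AddCommGroup V] [Module ℝ V] [AddCommGroup N] [Module ℝ N]
  {P : RootPairing ι ℝ V N} [P.IsRootSystem] (b : P.Base)

/-- The coefficient of the simple root `α_j` in a vector of `V`. -/
noncomputable def coord (j : b.support) : V →ₗ[ℝ] ℝ :=
  b.toWeightBasis.coord j

/-- The vectors all of whose coefficients with respect to the simple roots are nonnegative. A root
is positive if and only if it satisfies this predicate. -/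
def IsNonneg (v : V) : Prop :=
  ∀ j, 0 ≤ coord b j v

/-- The span of the simple roots `α_j`, `j ∈ J`, described by the vanishing of the other
coordinates. -/
def leviSpan (J : Set b.support) : Submodule ℝ V where
  carrier := {v | ∀ j ∉ J, coord b j v = 0}
  add_mem' := fun hx hy j hj ↦ by rw [map_add, hx j hj, hy j hj, add_zero]
  zero_mem' := fun j _ ↦ map_zero _
  smul_mem' := fun c x hx j hj ↦ by rw [map_smul, hx j hj, smul_zero]

variable {b}

variable (b) in
lemma coord_root_self (j : b.support) : coord b j (P.root j) = 1 := by
  rw [coord, ← b.toWeightBasis_apply, Basis.coord_apply, Basis.repr_self, Finsupp.single_eq_same]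

lemma coord_root_of_ne {i j : b.support} (h : i ≠ j) : coord b j (P.root i) = 0 := by
  rw [coord, ← b.toWeightBasis_apply, Basis.coord_apply, Basis.repr_self,
    Finsupp.single_eq_of_ne h.symm]

variable (b) in
lemma sum_coord_smul (v : V) : ∑ j, coord b j v • P.root j = v := by
  simpa [coord] using b.toWeightBasis.sum_repr v

lemma ext_coord {v w : V} (h : ∀ j, coord b j v = coord b j w) : v = w :=
  b.toWeightBasis.ext_elem h

lemma ext_simple {V' : Type*} [AddCommGroup V'] [Module ℝ V'] {f g : V →ₗ[ℝ] V'}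
    (h : ∀ j : b.support, f (P.root j) = g (P.root j)) : f = g :=
  b.toWeightBasis.ext fun j ↦ by simpa using h j

lemma eqOn_leviSpan {V' : Type*} [AddCommGroup V'] [Module ℝ V'] {J : Set b.support}
    {f g : V →ₗ[ℝ] V'} (h : ∀ j ∈ J, f (P.root j) = g (P.root j)) {v : V}
    (hv : v ∈ leviSpan b J) : f v = g v := by
  rw [← sum_coord_smul b v, map_sum, map_sum]
  refine Finset.sum_congr rfl fun j _ ↦ ?_
  by_cases hj : j ∈ J
  · rw [map_smul, map_smul, h j hj]
  · rw [hv j hj, zero_smul, map_zero, map_zero]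

lemma IsNonneg.zero : IsNonneg b (0 : V) := fun j ↦ (map_zero (coord b j)).ge

lemma IsNonneg.add {v w : V} (hv : IsNonneg b v) (hw : IsNonneg b w) : IsNonneg b (v + w) :=
  fun j ↦ by rw [map_add]; exact add_nonneg (hv j) (hw j)

variable (b) in
lemma isNonneg_simple (i : b.support) : IsNonneg b (P.root i) := by
  intro j
  rcases eq_or_ne i j with rfl | h
  · rw [coord_root_self]; exact zero_le_one
  · rw [coord_root_of_ne h]

variable (b) in
lemma simple_mem_leviSpan {J : Set b.support} {j : b.support} (hj : j ∈ J) :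
    P.root j ∈ leviSpan b J :=
  fun _ hk ↦ coord_root_of_ne fun h ↦ hk (h ▸ hj)

lemma eq_zero_of_isNonneg_neg {v : V} (h : IsNonneg b v) (h' : IsNonneg b (-v)) : v = 0 :=
  ext_coord fun j ↦ by
    have := h' j
    rw [map_neg] at this
    rw [map_zero]
    linarith [h j]

/-- A linear map sending the simple roots `α_j`, `j ∈ J`, to nonnegative vectors does the same with
every nonnegative vector in their span. -/
lemma IsNonneg.map {J : Set b.support} {f : V →ₗ[ℝ] V}
    (hf : ∀ j ∈ J, IsNonneg b (f (P.root j))) {v : V} (hv : IsNonneg b v)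
    (hJ : v ∈ leviSpan b J) : IsNonneg b (f v) := by
  intro k
  rw [← sum_coord_smul b v, map_sum, map_sum]
  refine Finset.sum_nonneg fun j _ ↦ ?_
  by_cases hj : j ∈ J
  · rw [map_smul, map_smul]
    exact mul_nonneg (hv j) (hf j hj k)
  · rw [hJ j hj, zero_smul, map_zero, map_zero]

variable (b) in
lemma isNonneg_or_neg (k : ι) : IsNonneg b (P.root k) ∨ IsNonneg b (-P.root k) := by
  have key : ∀ v ∈ AddSubmonoid.closure (P.root '' b.support), IsNonneg b v := by
    intro v hv
    induction hv using AddSubmonoid.closure_induction with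
    | mem x hx =>
      obtain ⟨i, hi, rfl⟩ := hx
      exact isNonneg_simple b ⟨i, hi⟩
    | zero => exact IsNonneg.zero
    | add x y _ _ hx hy => exact hx.add hy
  exact (b.root_mem_or_neg_mem k).imp (key _) (key _)

lemma not_isNonneg_neg {k : ι} (h : IsNonneg b (P.root k)) : ¬ IsNonneg b (-P.root k) :=
  fun h' ↦ P.ne_zero k (eq_zero_of_isNonneg_neg h h')

variable (b) in
lemma exists_coord_eq_int (k : ι) (j : b.support) : ∃ n : ℤ, coord b j (P.root k) = n := by
  have key : ∀ v ∈ AddSubmonoid.closure (P.root '' b.support), ∃ n : ℤ, coord b j v = n := by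
    intro v hv
    induction hv using AddSubmonoid.closure_induction with
    | mem x hx =>
      obtain ⟨i, hi, rfl⟩ := hx
      rcases eq_or_ne ⟨i, hi⟩ j with rfl | h
      · exact ⟨1, by simpa using coord_root_self b ⟨i, hi⟩⟩
      · exact ⟨0, by simpa using coord_root_of_ne h⟩
    | zero => exact ⟨0, by simp⟩
    | add x y _ _ hx hy =>
      obtain ⟨m, hm⟩ := hx
      obtain ⟨n, hn⟩ := hy
      exact ⟨m + n, by rw [map_add, hm, hn, Int.cast_add]⟩
  rcases b.root_mem_or_neg_mem k with h | h
  · exact key _ h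
  · obtain ⟨n, hn⟩ := key _ h
    exact ⟨-n, by rw [Int.cast_neg, ← hn, map_neg, neg_neg]⟩

variable {τ : Equiv.Perm b.support}

variable (b τ) in
/-- The sum of the coefficients of `α_i` and `α_{τ i}`. For `i ∉ X` it takes the same value on `β`
and on `β̃`. -/
noncomputable def coordPair (i : b.support) : V →ₗ[ℝ] ℝ :=
  coord b i + coord b (τ i)

lemma coordPair_simple_pos (i : b.support) : 0 < coordPair b τ i (P.root i) := by
  rw [coordPair, LinearMap.add_apply, coord_root_self]
  linarith [isNonneg_simple b i (τ i)]

lemma isNonneg_of_coordPair_pos {i : b.support} {k : ι} (h : 0 < coordPair b τ i (P.root k)) :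
    IsNonneg b (P.root k) := by
  refine (isNonneg_or_neg b k).resolve_right fun h' ↦ ?_
  have h1 := h' i
  have h2 := h' (τ i)
  rw [map_neg] at h1 h2
  rw [coordPair, LinearMap.add_apply] at h
  linarith

end Coordinates

/-! ### Simple reflections and positive roots -/

section Descent

variable {ι V N : Type*} [AddCommGroup V] [Module ℝ V] [AddCommGroup N] [Module ℝ N]
  {P : RootPairing ι ℝ V N}

lemma reflection_mem_leviSpan [P.IsRootSystem] {b : P.Base} {J : Set b.support} {j : b.support}
    (hj : j ∈ J) {v : V} (hv : v ∈ leviSpan b J) : P.reflection j v ∈ leviSpan b J := by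
  rw [P.reflection_apply]
  exact sub_mem hv (Submodule.smul_mem _ _ (simple_mem_leviSpan b hj))

lemma coord_reflection_of_ne [P.IsRootSystem] {b : P.Base} {i j : b.support} (h : i ≠ j) (v : V) :
    coord b j (P.reflection i v) = coord b j v := by
  rw [P.reflection_apply, map_sub, map_smul, coord_root_of_ne h, smul_zero, sub_zero]

/-- The simple reflection `s_j` permutes the positive roots other than `α_j`. -/
lemma isNonneg_reflection [P.IsRootSystem] [P.IsReduced] {b : P.Base} {k : ι} {j : b.support}
    (hk : IsNonneg b (P.root k)) (hkj : P.root k ≠ P.root j) :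
    IsNonneg b (P.reflection j (P.root k)) := by
  rw [← P.root_reflectionPerm]
  refine (isNonneg_or_neg b _).resolve_right fun h ↦ ?_
  rw [P.root_reflectionPerm] at h
  have h0 : P.root k = coord b j (P.root k) • P.root j := by
    refine ext_coord (b := b) fun i ↦ ?_
    rcases eq_or_ne j i with rfl | hij
    · rw [map_smul, coord_root_self, smul_eq_mul, mul_one]
    · have := h i
      rw [map_neg, coord_reflection_of_ne hij] at this
      rw [map_smul, coord_root_of_ne hij, smul_zero]
      linarith [hk i]
  have hdep : ¬ LinearIndependent ℝ ![P.root k, P.root j] := by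
    intro hli
    have := LinearIndependent.pair_iff.1 hli 1 (-coord b j (P.root k)) (by
      rw [one_smul, neg_smul, ← h0, add_neg_cancel])
    exact one_ne_zero this.1
  rcases RootPairing.IsReduced.eq_or_eq_neg k (j : ι) hdep with h1 | h1
  · exact hkj h1
  · refine not_isNonneg_neg (isNonneg_simple b j) ?_
    rwa [← h1]

variable [Fintype ι]

lemma normForm_reflection_right (P : RootPairing ι ℝ V N) (i : ι) (x y : V) :
    normForm P x (P.reflection i y) = normForm P (P.reflection i x) y := by
  rw [← normForm_reflection P i, P.reflection_same]

variable (P) in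
lemma normForm_root_pos (k : ι) : 0 < normForm P (P.root k) (P.root k) := by
  rw [normForm_root]
  exact mul_pos (div_pos two_pos (minRootForm_pos P k)) (rootForm_root_pos P k)

/-- `⟨v, α^∨⟩ = 2 (v, α) / (α, α)`. -/
lemma coroot'_mul_normForm (P : RootPairing ι ℝ V N) (k : ι) (v : V) :
    P.coroot' k v * normForm P (P.root k) (P.root k) = 2 * normForm P v (P.root k) := by
  have h := normForm_reflection_right P k v (P.root k)
  rw [P.reflection_apply_self, P.reflection_apply, map_neg, map_sub, LinearMap.sub_apply,
    map_smul, LinearMap.smul_apply, smul_eq_mul] at h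
  linarith

variable [P.IsRootSystem] {b : P.Base}

/-- A nonzero nonnegative vector `v` has positive pairing with the coroot of some simple root that
occurs in it, since otherwise `(v, v) ≤ 0`. -/
lemma exists_coord_pos_coroot'_pos {v : V} (hv : IsNonneg b v) (h0 : v ≠ 0) :
    ∃ j : b.support, 0 < coord b j v ∧ 0 < P.coroot' j v := by
  by_contra! h
  refine (normForm_pos P h0).not_ge ?_
  nth_rw 1 [← sum_coord_smul b v]
  rw [map_sum, LinearMap.sum_apply]
  refine Finset.sum_nonpos fun j _ ↦ ?_
  rw [map_smul, LinearMap.smul_apply, smul_eq_mul]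
  rcases (hv j).eq_or_lt with h1 | h1
  · rw [← h1, zero_mul]
  · refine mul_nonpos_of_nonneg_of_nonpos h1.le ?_
    have h2 := coroot'_mul_normForm P j v
    have h3 := mul_nonpos_of_nonpos_of_nonneg (h j h1) (normForm_root_pos P (j : ι)).le
    rw [normForm_symm]
    linarith

/-- Induction on the positive roots in the span of the `α_j`, `j ∈ J`: every such root is reached
from a simple root `α_j`, `j ∈ J`, by applying simple reflections `s_j`, `j ∈ J`. -/
lemma positive_root_induction [P.IsReduced] {J : Set b.support} {p : V → Prop}
    (simple : ∀ j ∈ J, p (P.root j))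
    (step : ∀ k, ∀ j ∈ J, p (P.reflection j (P.root k)) → p (P.root k))
    {k : ι} (hk : IsNonneg b (P.root k)) (hkJ : P.root k ∈ leviSpan b J) : p (P.root k) := by
  by_contra hp
  obtain ⟨k, ⟨hk, hkJ, hp⟩, hmin⟩ := Set.exists_min_image
    {k | IsNonneg b (P.root k) ∧ P.root k ∈ leviSpan b J ∧ ¬ p (P.root k)}
    (fun k ↦ ∑ j, coord b j (P.root k)) (Set.toFinite _) ⟨k, hk, hkJ, hp⟩
  obtain ⟨j, h1, h2⟩ := exists_coord_pos_coroot'_pos hk (P.ne_zero k)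
  have hj : j ∈ J := by
    by_contra hj
    exact h1.ne' (hkJ j hj)
  have hkj : P.root k ≠ P.root j := fun h ↦ hp (h ▸ simple j hj)
  have h3 := hmin (P.reflectionPerm j k) ⟨by
      rw [P.root_reflectionPerm]; exact isNonneg_reflection hk hkj, by
      rw [P.root_reflectionPerm]; exact reflection_mem_leviSpan hj hkJ, fun h ↦
      hp (step k j hj (by rwa [P.root_reflectionPerm] at h))⟩
  rw [P.root_reflectionPerm] at h3
  refine h3.not_gt (Finset.sum_lt_sum (fun i _ ↦ ?_) ⟨j, Finset.mem_univ _, ?_⟩)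
  · rcases eq_or_ne j i with rfl | hij
    · rw [P.reflection_apply, map_sub, map_smul, coord_root_self, smul_eq_mul, mul_one]
      linarith
    · rw [coord_reflection_of_ne hij]
  · rw [P.reflection_apply, map_sub, map_smul, coord_root_self, smul_eq_mul, mul_one]
    linarith

end Descent

/-! ### The Weyl group: exchange condition and longest elements -/

section Weyl

variable {ι V N : Type*} [AddCommGroup V] [Module ℝ V] [AddCommGroup N] [Module ℝ N]
  {P : RootPairing ι ℝ V N}

/-- A linear map that preserves the form conjugates the reflections at roots into each other. -/
lemma reflection_conj [Fintype ι] {f : V →ₗ[ℝ] V}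
    (hf : ∀ x y, normForm P (f x) (f y) = normForm P x y) {k m : ι}
    (h : f (P.root k) = P.root m) (v : V) : f (P.reflection k v) = P.reflection m (f v) := by
  have h1 := coroot'_mul_normForm P m (f v)
  rw [← h, hf, hf, ← coroot'_mul_normForm P k v] at h1
  rw [P.reflection_apply, P.reflection_apply, mul_right_cancel₀ (normForm_root_pos P k).ne' h1,
    map_sub, map_smul, h]

variable {b : P.Base}

lemma reflection_mem_parabolic {J : Set b.support} {j : b.support} (hj : j ∈ J) :
    P.reflection j ∈ parabolic b J :=
  Subgroup.subset_closure ⟨j, hj, rfl⟩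

lemma parabolic_induction {J : Set b.support} {p : ∀ w, w ∈ parabolic b J → Prop}
    (one : p 1 (one_mem _))
    (mul : ∀ (j) (hj : j ∈ J) (w) (hw : w ∈ parabolic b J), p w hw →
      p (P.reflection j * w) (mul_mem (reflection_mem_parabolic hj) hw))
    {w : V ≃ₗ[ℝ] V} (hw : w ∈ parabolic b J) : p w hw := by
  induction hw using Subgroup.closure_induction_left with
  | one => exact one
  | mul_left x hx y hy h =>
    obtain ⟨j, hj, rfl⟩ := hx
    exact mul j hj y hy h
  | inv_mul_cancel x hx y hy h =>
    obtain ⟨j, hj, rfl⟩ := hx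
    exact mul j hj y hy h

lemma parabolic_apply_root {J : Set b.support} {w : V ≃ₗ[ℝ] V} (hw : w ∈ parabolic b J) (k : ι) :
    ∃ m, w (P.root k) = P.root m := by
  induction hw using parabolic_induction with
  | one => exact ⟨k, rfl⟩
  | mul j _ w _ h =>
    obtain ⟨m, hm⟩ := h
    exact ⟨P.reflectionPerm j m, by rw [P.root_reflectionPerm, ← hm]; rfl⟩

lemma normForm_parabolic [Fintype ι] {J : Set b.support} {w : V ≃ₗ[ℝ] V}
    (hw : w ∈ parabolic b J) (x y : V) : normForm P (w x) (w y) = normForm P x y := by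
  induction hw using parabolic_induction with
  | one => rfl
  | mul j _ w _ h => exact (normForm_reflection P j _ _).trans h

lemma parabolic_apply_sub_mem [P.IsRootSystem] {J : Set b.support} {w : V ≃ₗ[ℝ] V}
    (hw : w ∈ parabolic b J) (v : V) : w v - v ∈ leviSpan b J := by
  induction hw using parabolic_induction with
  | one => rw [LinearEquiv.coe_one, id, sub_self]; exact zero_mem _
  | mul j hj w _ h =>
    have : (P.reflection j * w) v - v = (w v - v) - P.coroot' j (w v) • P.root j := by
      rw [LinearEquiv.mul_apply, P.reflection_apply]
      abel
    rw [this]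
    exact sub_mem h (Submodule.smul_mem _ _ (simple_mem_leviSpan b hj))

lemma parabolic_mem_leviSpan [P.IsRootSystem] {J : Set b.support} {w : V ≃ₗ[ℝ] V}
    (hw : w ∈ parabolic b J) {v : V} (hv : v ∈ leviSpan b J) : w v ∈ leviSpan b J := by
  simpa using add_mem (parabolic_apply_sub_mem hw v) hv

/-- The product of simple reflections spelled by a word. -/
def wordProd (l : List b.support) : V ≃ₗ[ℝ] V :=
  (l.map fun i : b.support ↦ P.reflection i).prod

lemma wordProd_cons (i : b.support) (l : List b.support) :
    wordProd (i :: l) = P.reflection i * wordProd l := by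
  rw [wordProd, List.map_cons, List.prod_cons, wordProd]

lemma wordProd_mem_parabolic {J : Set b.support} {l : List b.support} (hl : ∀ i ∈ l, i ∈ J) :
    wordProd l ∈ parabolic b J := by
  refine Subgroup.list_prod_mem _ fun x hx ↦ ?_
  obtain ⟨i, hi, rfl⟩ := List.mem_map.1 hx
  exact reflection_mem_parabolic (hl i hi)

lemma exists_word {J : Set b.support} {w : V ≃ₗ[ℝ] V} (hw : w ∈ parabolic b J) :
    ∃ l : List b.support, (∀ i ∈ l, i ∈ J) ∧ wordProd l = w := by
  induction hw using parabolic_induction with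
  | one => exact ⟨[], by simp, rfl⟩
  | mul j hj w _ h =>
    obtain ⟨l, hl, rfl⟩ := h
    exact ⟨j :: l, by simpa [hj] using hl, wordProd_cons j l⟩

lemma mul_reflection_mul_reflection (w : V ≃ₗ[ℝ] V) (j : ι) :
    w * P.reflection j * P.reflection j = w := by
  rw [mul_assoc, ← sq, P.reflection_sq, mul_one]

variable [Fintype ι] [P.IsRootSystem] [P.IsReduced]

/-- The exchange condition: if `w α_j` is negative for a product `w` of simple reflections, then
`w s_j` is obtained from that product by leaving out one factor. -/
lemma exchange (l : List b.support) (j : b.support)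
    (h : IsNonneg b (-wordProd l (P.root j))) :
    ∃ l' : List b.support, (∀ i ∈ l', i ∈ l) ∧ l'.length + 1 = l.length ∧
      wordProd l' = wordProd l * P.reflection j := by
  induction l with
  | nil => exact absurd h (not_isNonneg_neg (isNonneg_simple b j))
  | cons k l ih =>
    have hw := wordProd_mem_parabolic (fun i (_ : i ∈ l) ↦ Set.mem_univ i)
    obtain ⟨m, hm⟩ := parabolic_apply_root hw j
    rcases isNonneg_or_neg b m with hpos | hneg
    · have hmk : P.root m = P.root k := by
        by_contra hne
        have h1 := isNonneg_reflection hpos hne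
        rw [← P.root_reflectionPerm] at h1
        refine not_isNonneg_neg h1 ?_
        rwa [P.root_reflectionPerm, ← hm, ← LinearEquiv.mul_apply, ← wordProd_cons]
      have hc : wordProd l * P.reflection j = P.reflection k * wordProd l :=
        LinearEquiv.ext fun v ↦ reflection_conj (f := (wordProd l).toLinearMap)
          (normForm_parabolic hw) (hm.trans hmk) v
      refine ⟨l, fun i hi ↦ List.mem_cons_of_mem _ hi, rfl, ?_⟩
      rw [wordProd_cons, ← hc, mul_reflection_mul_reflection]
    · obtain ⟨l', h1, h2, h3⟩ := ih (hm ▸ hneg)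
      refine ⟨k :: l', ?_, by simp [h2], by rw [wordProd_cons, wordProd_cons, h3, mul_assoc]⟩
      intro i hi
      rcases List.mem_cons.1 hi with rfl | hi
      · exact List.mem_cons_self
      · exact List.mem_cons_of_mem _ (h1 i hi)

/-- An element of `W_J` sending every `α_j`, `j ∈ J`, to a positive root is the identity. -/
lemma eq_one_of_isNonneg {J : Set b.support} {w : V ≃ₗ[ℝ] V} (hw : w ∈ parabolic b J)
    (h : ∀ j ∈ J, IsNonneg b (w (P.root j))) : w = 1 := by
  classical
  have hex : ∃ n, ∃ l : List b.support, l.length = n ∧ (∀ i ∈ l, i ∈ J) ∧ wordProd l = w := by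
    obtain ⟨l, hl, hlw⟩ := exists_word hw
    exact ⟨_, l, rfl, hl, hlw⟩
  obtain ⟨l, hlen, hl, hlw⟩ := Nat.find_spec hex
  rcases List.eq_nil_or_concat' l with rfl | ⟨l, j, rfl⟩
  · exact hlw.symm
  · have hlj : wordProd l * P.reflection j = w := by
      rw [← hlw, wordProd, wordProd]
      simp
    have hj : j ∈ J := hl j (by simp)
    have hneg : IsNonneg b (-wordProd l (P.root j)) := by
      have := h j hj
      rwa [← hlj, LinearEquiv.mul_apply, P.reflection_apply_self, map_neg] at this
    obtain ⟨l', h1, h2, h3⟩ := exchange l j hneg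
    have := Nat.find_min' hex ⟨l', rfl, fun i hi ↦ hl i (by simp [h1 i hi]), h3.trans hlj⟩
    rw [← hlen, List.length_append, List.length_singleton] at this
    omega

/-- The longest element of `W_J` sends each `α_j`, `j ∈ J`, to a negative root. -/
lemma longest_apply_simple (J : Set b.support) {j : b.support} (hj : j ∈ J) :
    IsNonneg b (-longest b J (P.root j)) := by
  obtain ⟨hmem, hmax⟩ := isLongest_longest b J
  obtain ⟨m, hm⟩ := parabolic_apply_root hmem j
  rw [hm]
  refine (isNonneg_or_neg b m).resolve_left fun hpos ↦ ?_
  -- If `w_J α_j` were positive, the exchange condition for `w_J s_j` would make `w_J` shorter.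
  have hw : longest b J * P.reflection j ∈ parabolic b J :=
    mul_mem hmem (reflection_mem_parabolic hj)
  obtain ⟨l₀, -, hl₀⟩ := exists_word hw
  have hne : {n | ∃ l : List b.support, l.length = n ∧
      (l.map fun i : b.support ↦ P.reflection i).prod = longest b J * P.reflection j}.Nonempty :=
    ⟨_, l₀, rfl, hl₀⟩
  obtain ⟨l, hlen, hl⟩ := Nat.sInf_mem hne
  change l.length = length b _ at hlen
  change wordProd l = _ at hl
  obtain ⟨l', -, h2, h3⟩ := exchange l j (by
    rwa [hl, LinearEquiv.mul_apply, P.reflection_apply_self, map_neg, hm, neg_neg])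
  rw [hl, mul_reflection_mul_reflection] at h3
  have h4 : length b (longest b J) ≤ l'.length := Nat.sInf_le ⟨l', rfl, h3⟩
  have h5 := hmax _ hw
  omega

/-- The reflection at a root in the span of the `α_j`, `j ∈ J`, belongs to `W_J`. -/
lemma reflection_mem_parabolic_of_mem_leviSpan {J : Set b.support} {k : ι}
    (hk : P.root k ∈ leviSpan b J) : P.reflection k ∈ parabolic b J := by
  have key : ∀ k, IsNonneg b (P.root k) → P.root k ∈ leviSpan b J →
      P.reflection k ∈ parabolic b J := by
    intro k hk hkJ
    refine positive_root_induction (p := fun v ↦ ∀ k, P.root k = v →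
      P.reflection k ∈ parabolic b J) ?_ ?_ hk hkJ k rfl
    · intro j hj k hk
      rw [P.root.injective hk]
      exact reflection_mem_parabolic hj
    · intro k j hj h k' hk'
      rw [P.root.injective hk']
      have := h (P.reflectionPerm j k) (P.root_reflectionPerm j k)
      rw [P.reflection_reflectionPerm] at this
      have hj' := reflection_mem_parabolic hj
      rwa [Subgroup.mul_mem_cancel_right _ hj', Subgroup.mul_mem_cancel_left _ hj'] at this
  rcases isNonneg_or_neg b k with h | h
  · exact key k h hk
  · have h1 : P.root (P.reflectionPerm k k) = -P.root k := by
      rw [P.root_reflectionPerm, P.reflection_apply_self]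
    have h2 := key (P.reflectionPerm k k) (h1 ▸ h) (h1 ▸ neg_mem hk)
    rwa [P.reflection_reflectionPerm, ← sq, P.reflection_sq, one_mul] at h2

/-- An element of `W_K` which keeps the `W_X`-conjugates of the simple roots `α_k`, `k ∈ K \ X`,
positive belongs to `W_X`. -/
lemma mem_parabolic_of_isNonneg {X K : Set b.support} {w : V ≃ₗ[ℝ] V}
    (hw : w ∈ parabolic b K)
    (h : ∀ u ∈ parabolic b X, ∀ k ∈ K, k ∉ X → IsNonneg b (w (u (P.root k)))) :
    w ∈ parabolic b X := by
  obtain ⟨l, hl, rfl⟩ := exists_word hw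
  induction hn : l.length using Nat.strong_induction_on generalizing l with
  | _ n ih =>
  by_cases hpos : ∀ j ∈ K, IsNonneg b (wordProd l (P.root j))
  · rw [eq_one_of_isNonneg hw hpos]
    exact one_mem _
  · push Not at hpos
    obtain ⟨j, hjK, hj⟩ := hpos
    have hjX : j ∈ X := by
      by_contra hjX
      exact hj (h 1 (one_mem _) j hjK hjX)
    obtain ⟨m, hm⟩ := parabolic_apply_root hw j
    rw [hm] at hj
    obtain ⟨l', h1, h2, h3⟩ := exchange l j (hm ▸ (isNonneg_or_neg b m).resolve_left hj)
    have hl' : ∀ i ∈ l', i ∈ K := fun i hi ↦ hl i (h1 i hi)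
    have h4 := ih l'.length (by omega) l' hl' (wordProd_mem_parabolic hl') (fun u hu k hk hkX ↦ by
      rw [h3]
      exact h (P.reflection j * u) (mul_mem (reflection_mem_parabolic hjX) hu) k hk hkX) rfl
    rwa [h3, Subgroup.mul_mem_cancel_right _ (reflection_mem_parabolic hjX)] at h4

end Weyl

/-! ### Automorphisms of the root system -/

section Automorphisms

variable {ι V N : Type*} [AddCommGroup V] [Module ℝ V] [AddCommGroup N] [Module ℝ N]
  {P : RootPairing ι ℝ V N} [P.IsRootSystem]

/-- A linear automorphism that permutes the roots induces a permutation of their indices and is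
compatible with the coroots. -/
lemma exists_perm_of_permutes_roots [Finite ι] {f : V ≃ₗ[ℝ] V}
    (hf : ∀ k, ∃ m, f (P.root k) = P.root m) :
    ∃ π : Equiv.Perm ι, (∀ k, f (P.root k) = P.root (π k)) ∧
      ∀ k v, P.coroot' (π k) (f v) = P.coroot' k v := by
  choose π hπ using hf
  have hinj : Function.Injective π := fun k m h ↦
    P.root.injective (f.injective (by rw [hπ, hπ, h]))
  have hsurj := Finite.surjective_of_injective hinj
  refine ⟨Equiv.ofBijective π ⟨hinj, hsurj⟩, hπ, fun k v ↦ ?_⟩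
  have h2 : P.coroot' (π k) (f (P.root k)) = 2 := by
    rw [hπ]
    exact P.root_coroot_two _
  have h := Dual.eq_of_preReflection_mapsTo (x := P.root k) (Set.finite_range P.root)
    RootPairing.IsRootSystem.span_root_eq_top (f := P.coroot' (π k) ∘ₗ f.toLinearMap)
    (g := P.coroot' k) h2 ?_ (P.root_coroot_two k) (P.mapsTo_reflection_root k)
  · exact LinearMap.congr_fun h v
  · rintro _ ⟨m, rfl⟩
    obtain ⟨n, hn⟩ := hsurj (P.reflectionPerm (π k) (π m))
    refine ⟨n, f.injective ?_⟩
    rw [hπ, hn, P.root_reflectionPerm, P.reflection_apply, preReflection_apply, map_sub, map_smul,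
      hπ, hπ, LinearMap.comp_apply, LinearEquiv.coe_coe, hπ]

/-- The normalised form is invariant under all automorphisms of the root system. -/
lemma normForm_of_permutes_roots [Fintype ι] {f : V ≃ₗ[ℝ] V}
    (hf : ∀ k, ∃ m, f (P.root k) = P.root m) (x y : V) :
    normForm P (f x) (f y) = normForm P x y := by
  obtain ⟨π, hπ, hco⟩ := exists_perm_of_permutes_roots hf
  have hpair : ∀ k m, P.pairing (π k) (π m) = P.pairing k m := fun k m ↦ by
    rw [← P.root_coroot'_eq_pairing, ← hπ, hco, P.root_coroot'_eq_pairing]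
  have hcomp : ∀ k m, SameComponent P (π k) (π m) ↔ SameComponent P k m := by
    intro k m
    have key : ∀ σ : Equiv.Perm ι, (∀ k m, P.pairing (σ k) (σ m) = P.pairing k m) → ∀ k m,
        SameComponent P k m → SameComponent P (σ k) (σ m) := by
      intro σ hσ k m h
      induction h with
      | rel k m h => exact .rel _ _ (by rwa [hσ])
      | refl => exact .refl _
      | symm _ _ _ ih => exact .symm _ _ ih
      | trans _ _ _ _ _ ih₁ ih₂ => exact .trans _ _ _ ih₁ ih₂
    refine ⟨fun h ↦ ?_, key π hpair k m⟩
    have := key π.symm (fun k m ↦ by rw [← hpair]; simp) _ _ h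
    simpa using this
  have hroot : ∀ k, P.RootForm (P.root (π k)) (P.root (π k)) =
      P.RootForm (P.root k) (P.root k) := by
    intro k
    rw [P.rootForm_apply_apply, P.rootForm_apply_apply]
    refine (Fintype.sum_equiv π _ _ fun m ↦ ?_).symm
    rw [P.root_coroot'_eq_pairing, P.root_coroot'_eq_pairing, hpair]
  have hmin : ∀ k, minRootForm P (π k) = minRootForm P k := by
    intro k
    refine (Equiv.iInf_congr (π.subtypeEquiv fun m ↦ (hcomp k m).symm) fun m ↦ ?_).symm
    exact hroot m
  rw [normForm_apply, normForm_apply]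
  refine (Fintype.sum_equiv π _ _ fun k ↦ ?_).symm
  rw [hmin, hco, hco]

variable {b : P.Base} [P.IsCrystallographic] {τ : Equiv.Perm b.support}

lemma permAut_reflection (hτ : ∀ i j, b.cartanMatrix (τ i) (τ j) = b.cartanMatrix i j)
    (j : b.support) (v : V) :
    permAut b τ (P.reflection j v) = P.reflection (τ j) (permAut b τ v) := by
  have h : (permAut b τ).toLinearMap ∘ₗ (P.reflection j).toLinearMap =
      (P.reflection (τ j)).toLinearMap ∘ₗ (permAut b τ).toLinearMap := by
    refine ext_simple (b := b) fun i ↦ ?_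
    have hp : P.pairing (τ i) (τ j) = P.pairing i j := by
      rw [← P.algebraMap_pairingIn ℤ, ← P.algebraMap_pairingIn ℤ (i : ι)]
      exact congrArg _ (hτ i j)
    simp only [LinearMap.comp_apply, LinearEquiv.coe_coe]
    rw [P.reflection_apply_root, map_sub, map_smul, permAut_root, permAut_root,
      P.reflection_apply_root, hp]
  exact LinearMap.congr_fun h v

/-- A diagram automorphism extends to an automorphism of the root system. -/
lemma permAut_apply_root [Finite ι] [P.IsReduced]
    (hτ : ∀ i j, b.cartanMatrix (τ i) (τ j) = b.cartanMatrix i j) (k : ι) :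
    ∃ m, permAut b τ (P.root k) = P.root m := by
  refine b.induction_reflect k (p := fun k ↦ ∃ m, permAut b τ (P.root k) = P.root m) ?_ ?_ ?_
  · rintro i ⟨m, hm⟩
    refine ⟨P.reflectionPerm m m, ?_⟩
    rw [P.root_reflectionPerm, P.root_reflectionPerm, P.reflection_apply_self, map_neg, hm,
      P.reflection_apply_self]
  · exact fun i hi ↦ ⟨_, permAut_root b τ ⟨i, hi⟩⟩
  · rintro i j ⟨m, hm⟩ hj
    refine ⟨P.reflectionPerm (τ ⟨j, hj⟩) m, ?_⟩
    rw [P.root_reflectionPerm, P.root_reflectionPerm, ← hm]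
    exact permAut_reflection hτ ⟨j, hj⟩ _

end Automorphisms

/-! ### The involution `Θ` -/

section Theta

variable {ι V N : Type*} [Fintype ι] [AddCommGroup V] [Module ℝ V] [AddCommGroup N] [Module ℝ N]
  {P : RootPairing ι ℝ V N} [P.IsRootSystem]
  {b : P.Base} {X : Set b.support} {τ : Equiv.Perm b.support}

lemma theta_apply (v : V) : Theta b X τ v = -longest b X (permAut b τ v) := rfl

namespace IsSatakeDiagram

variable [P.IsCrystallographic] (hS : IsSatakeDiagram b X τ)
include hS

lemma mem_iff (i : b.support) : τ i ∈ X ↔ i ∈ X := by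
  constructor
  · intro h
    rw [← hS.involutive i, ← hS.image_eq]
    exact ⟨_, h, rfl⟩
  · intro h
    rw [← hS.image_eq]
    exact ⟨_, h, rfl⟩

lemma longest_simple {i : b.support} (hi : i ∈ X) :
    longest b X (P.root i) = -P.root (τ i) := by
  rw [← hS.neg_longest i hi, neg_neg]

lemma permAut_permAut (v : V) : permAut b τ (permAut b τ v) = v := by
  have h : (permAut b τ).toLinearMap ∘ₗ (permAut b τ).toLinearMap = LinearMap.id :=
    ext_simple (b := b) fun i ↦ by
      simp [permAut_root, hS.involutive]
  exact LinearMap.congr_fun h v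

lemma theta_simple {j : b.support} (hj : j ∈ X) : Theta b X τ (P.root j) = P.root j := by
  rw [theta_apply, permAut_root, hS.longest_simple ((hS.mem_iff j).2 hj), neg_neg, hS.involutive]

lemma theta_of_mem_leviSpan {v : V} (hv : v ∈ leviSpan b X) : Theta b X τ v = v :=
  eqOn_leviSpan (g := LinearMap.id) (fun _ hj ↦ hS.theta_simple hj) hv

lemma coord_theta {k : b.support} (hk : k ∉ X) (v : V) :
    coord b k (Theta b X τ v) = -coord b (τ k) v := by
  have h1 := parabolic_apply_sub_mem (isLongest_longest b X).1 (permAut b τ v) k hk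
  rw [map_sub, sub_eq_zero] at h1
  have h2 : coord b k ∘ₗ (permAut b τ).toLinearMap = coord b (τ k) := by
    refine ext_simple (b := b) fun i ↦ ?_
    rw [LinearMap.comp_apply, LinearEquiv.coe_coe, permAut_root]
    rcases eq_or_ne i (τ k) with rfl | h
    · rw [hS.involutive, coord_root_self, coord_root_self]
    · rw [coord_root_of_ne h, coord_root_of_ne]
      rintro rfl
      exact h (hS.involutive i).symm
  rw [theta_apply, map_neg, h1, ← h2]
  rfl

/-- A root fixed by `Θ` lies in the span of the simple roots of `X`. -/
lemma mem_leviSpan_of_theta_root {k : ι} (h : Theta b X τ (P.root k) = P.root k) :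
    P.root k ∈ leviSpan b X := by
  intro j hj
  have h1 := hS.coord_theta hj (P.root k)
  rw [h] at h1
  rcases isNonneg_or_neg b k with hk | hk
  · linarith [hk j, hk (τ j)]
  · have h2 := hk j
    have h3 := hk (τ j)
    rw [map_neg] at h2 h3
    linarith

variable [P.IsReduced]

/-- The element `(w_X τ)²` belongs to `W_X` and fixes the simple roots of `X`; hence it is `1`. -/
lemma theta_theta (v : V) : Theta b X τ (Theta b X τ v) = v := by
  have hconj : ∀ w ∈ parabolic b X, permAut b τ * w * (permAut b τ)⁻¹ ∈ parabolic b X := by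
    intro w hw
    induction hw using parabolic_induction with
    | one => simp
    | mul j hj w hw ih =>
      have h1 : permAut b τ * P.reflection j = P.reflection (τ j) * permAut b τ :=
        LinearEquiv.ext fun v ↦ permAut_reflection hS.diagram j v
      rw [← mul_assoc, h1, mul_assoc, mul_assoc, ← mul_assoc (permAut b τ)]
      exact mul_mem (reflection_mem_parabolic ((hS.mem_iff j).2 hj)) ih
  have hg : ∀ v, Theta b X τ (Theta b X τ v) =
      (longest b X * (permAut b τ * longest b X * (permAut b τ)⁻¹)) v := by
    intro v
    have h1 : (permAut b τ)⁻¹ v = permAut b τ v := by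
      rw [LinearEquiv.coe_inv, LinearEquiv.symm_apply_eq, hS.permAut_permAut]
    rw [theta_apply, theta_apply, map_neg, map_neg, neg_neg, LinearEquiv.mul_apply,
      LinearEquiv.mul_apply, LinearEquiv.mul_apply, h1]
  have h1 := eq_one_of_isNonneg
    (mul_mem (isLongest_longest b X).1 (hconj _ (isLongest_longest b X).1)) fun j hj ↦ by
      rw [← hg, hS.theta_simple hj, hS.theta_simple hj]
      exact isNonneg_simple b j
  rw [hg, h1]
  rfl

lemma theta_root (k : ι) : ∃ m, Theta b X τ (P.root k) = P.root m := by
  obtain ⟨m, hm⟩ := permAut_apply_root hS.diagram k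
  obtain ⟨n, hn⟩ := parabolic_apply_root (isLongest_longest b X).1 m
  refine ⟨P.reflectionPerm n n, ?_⟩
  rw [theta_apply, hm, hn, P.root_reflectionPerm, P.reflection_apply_self]

lemma normForm_theta (x y : V) :
    normForm P (Theta b X τ x) (Theta b X τ y) = normForm P x y :=
  normForm_of_permutes_roots (f := LinearEquiv.ofInvolutive (Theta b X τ) hS.theta_theta)
    hS.theta_root x y

lemma theta_reflection {k m : ι} (h : Theta b X τ (P.root k) = P.root m) (v : V) :
    Theta b X τ (P.reflection k v) = P.reflection m (Theta b X τ v) :=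
  reflection_conj hS.normForm_theta h v

end IsSatakeDiagram

end Theta

/-! ### Normality: `α + Θ α` is not a root -/

section Rho

variable {ι V N : Type*} [Fintype ι] [AddCommGroup V] [Module ℝ V] [AddCommGroup N] [Module ℝ N]
  {P : RootPairing ι ℝ V N} [P.IsRootSystem]
  {b : P.Base} {X : Set b.support} {τ : Equiv.Perm b.support}

open scoped Classical in
/-- The indices of the positive roots in the span of the simple roots of `X`. -/
noncomputable def posLevi (b : P.Base) (X : Set b.support) : Finset ι :=
  {k | IsNonneg b (P.root k) ∧ P.root k ∈ leviSpan b X}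

lemma mem_posLevi {k : ι} :
    k ∈ posLevi b X ↔ IsNonneg b (P.root k) ∧ P.root k ∈ leviSpan b X := by
  simp [posLevi]

lemma root_mem_closure_iff (k : ι) :
    P.root k ∈ AddSubmonoid.closure ((fun i : b.support ↦ P.root i) '' X) ↔ k ∈ posLevi b X := by
  rw [mem_posLevi]
  constructor
  · intro h
    generalize P.root k = v at h
    induction h using AddSubmonoid.closure_induction with
    | mem x hx =>
      obtain ⟨i, hi, rfl⟩ := hx
      exact ⟨isNonneg_simple b i, simple_mem_leviSpan b hi⟩
    | zero => exact ⟨IsNonneg.zero, zero_mem _⟩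
    | add x y _ _ hx hy => exact ⟨hx.1.add hy.1, add_mem hx.2 hy.2⟩
  · rintro ⟨h1, h2⟩
    rw [← sum_coord_smul b (P.root k)]
    refine sum_mem fun j _ ↦ ?_
    by_cases hj : j ∈ X
    · obtain ⟨n, hn⟩ := exists_coord_eq_int b k j
      have h3 := h1 j
      rw [hn, Int.cast_nonneg_iff] at h3
      obtain ⟨m, rfl⟩ := Int.eq_ofNat_of_zero_le h3
      rw [hn, Int.cast_natCast, Nat.cast_smul_eq_nsmul]
      exact nsmul_mem (AddSubmonoid.subset_closure (Set.mem_image_of_mem _ hj)) _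
    · rw [h2 j hj, zero_smul]
      exact zero_mem _

lemma toLinearMap_rhoCheck (v : V) :
    P.toLinearMap v (rhoCheck b X) = 1 / 2 * ∑ k ∈ posLevi b X, P.coroot' k v := by
  have h : {k : ι | P.root k ∈ AddSubmonoid.closure ((fun i : b.support ↦ P.root i) '' X)} =
      (posLevi b X : Set ι) := by
    ext k
    exact root_mem_closure_iff k
  rw [rhoCheck, h, finsum_mem_coe_finset, map_smul, map_sum, smul_eq_mul]
  rfl

/-- `ρ_X^∨` is invariant under the automorphisms of the root system that preserve the positive roots
in the span of `X`. -/
lemma toLinearMap_rhoCheck_of_permutes {f : V ≃ₗ[ℝ] V}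
    (hf : ∀ k, ∃ m, f (P.root k) = P.root m)
    (hX : ∀ j ∈ X, ∃ i ∈ X, f (P.root j) = P.root i) (v : V) :
    P.toLinearMap (f v) (rhoCheck b X) = P.toLinearMap v (rhoCheck b X) := by
  obtain ⟨π, hπ, hco⟩ := exists_perm_of_permutes_roots hf
  have hmap : (posLevi b X).map π.toEmbedding = posLevi b X := by
    refine Finset.map_eq_of_subset fun m hm ↦ ?_
    obtain ⟨k, hk, rfl⟩ := Finset.mem_map.1 hm
    rw [mem_posLevi] at hk ⊢
    rw [Equiv.toEmbedding_apply, ← hπ]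
    constructor
    · refine IsNonneg.map (f := f.toLinearMap) (fun j hj ↦ ?_) hk.1 hk.2
      obtain ⟨i, -, hi⟩ := hX j hj
      rw [LinearEquiv.coe_coe, hi]
      exact isNonneg_simple b i
    · rw [← sum_coord_smul b (P.root k), map_sum]
      refine sum_mem fun j _ ↦ ?_
      by_cases hj : j ∈ X
      · obtain ⟨i, hiX, hi⟩ := hX j hj
        rw [map_smul, hi]
        exact Submodule.smul_mem _ _ (simple_mem_leviSpan b hiX)
      · rw [hk.2 j hj, zero_smul, map_zero]
        exact zero_mem _
  rw [toLinearMap_rhoCheck, toLinearMap_rhoCheck]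
  congr 1
  conv_lhs => rw [← hmap]
  rw [Finset.sum_map]
  exact Finset.sum_congr rfl fun k _ ↦ hco k v

lemma toLinearMap_simple_rhoCheck [P.IsReduced] {j : b.support} (hj : j ∈ X) :
    P.toLinearMap (P.root j) (rhoCheck b X) = 1 := by
  classical
  have hjp : (j : ι) ∈ posLevi b X :=
    mem_posLevi.2 ⟨isNonneg_simple b j, simple_mem_leviSpan b hj⟩
  have hmap : ((posLevi b X).erase j).map (P.reflectionPerm j).toEmbedding =
      (posLevi b X).erase j := by
    refine Finset.map_eq_of_subset fun m hm ↦ ?_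
    obtain ⟨k, hk, rfl⟩ := Finset.mem_map.1 hm
    rw [Finset.mem_erase, mem_posLevi] at hk ⊢
    obtain ⟨h1, h2, h3⟩ := hk
    have hne : P.root k ≠ P.root j := fun h ↦ h1 (P.root.injective h)
    rw [Equiv.toEmbedding_apply, P.root_reflectionPerm]
    refine ⟨fun h ↦ ?_, isNonneg_reflection h2 hne, reflection_mem_leviSpan hj h3⟩
    have h4 : P.root k = -P.root j := by
      rw [← P.reflection_same j (P.root k), ← P.root_reflectionPerm, h, P.reflection_apply_self]
    exact not_isNonneg_neg (isNonneg_simple b j) (h4 ▸ h2)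
  -- The sum over the positive coroots other than `α_j^∨` is antiinvariant under `s_j` at `α_j`.
  have h0 : ∑ k ∈ (posLevi b X).erase j, P.coroot' k (P.root j) =
      -∑ k ∈ (posLevi b X).erase j, P.coroot' k (P.root j) := by
    conv_lhs => rw [← hmap]
    rw [Finset.sum_map, ← Finset.sum_neg_distrib]
    refine Finset.sum_congr rfl fun k _ ↦ ?_
    rw [Equiv.toEmbedding_apply, ← P.coroot'_reflection, P.reflection_apply_self, map_neg]
  rw [toLinearMap_rhoCheck, ← Finset.add_sum_erase _ _ hjp, P.root_coroot'_eq_pairing,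
    P.pairing_same]
  linarith

lemma exists_two_mul_rhoCheck_eq_int [P.IsCrystallographic] (k : ι) :
    ∃ n : ℤ, 2 * P.toLinearMap (P.root k) (rhoCheck b X) = n := by
  refine ⟨∑ m ∈ posLevi b X, P.pairingIn ℤ k m, ?_⟩
  rw [toLinearMap_rhoCheck, Int.cast_sum, ← mul_assoc, mul_one_div_cancel two_ne_zero, one_mul]
  refine Finset.sum_congr rfl fun m _ ↦ ?_
  rw [P.root_coroot'_eq_pairing, ← P.algebraMap_pairingIn ℤ]
  rfl

namespace IsSatakeDiagram

variable [P.IsCrystallographic] [P.IsReduced] (hS : IsSatakeDiagram b X τ)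
include hS

/-- If the coefficients of a root outside `X` are `τ`-invariant, then its pairing with `ρ_X^∨` is an
integer. The simple roots `α_j` with `τ j = j` contribute integers by assumption, and the other ones
outside `X` contribute in pairs of equal half-integers. -/
lemma exists_rhoCheck_eq_int {k : ι}
    (hk : ∀ j ∉ X, coord b (τ j) (P.root k) = coord b j (P.root k)) :
    ∃ n : ℤ, P.toLinearMap (P.root k) (rhoCheck b X) = n := by
  have hτ : ∀ j, P.toLinearMap (P.root (τ j)) (rhoCheck b X) =
      P.toLinearMap (P.root j) (rhoCheck b X) := by
    intro j
    rw [← permAut_root]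
    exact toLinearMap_rhoCheck_of_permutes (permAut_apply_root hS.diagram)
      (fun i hi ↦ ⟨τ i, (hS.mem_iff i).2 hi, permAut_root b τ i⟩) _
  let q : ℝ →+ ℝ ⧸ AddSubgroup.zmultiples (1 : ℝ) := QuotientAddGroup.mk' _
  have hq : ∀ x : ℝ, q x = 0 ↔ ∃ n : ℤ, x = n := fun x ↦ by
    rw [QuotientAddGroup.mk'_apply, QuotientAddGroup.eq_zero_iff, AddSubgroup.mem_zmultiples_iff]
    simp [eq_comm]
  have hsum : P.toLinearMap (P.root k) (rhoCheck b X) =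
      ∑ j : b.support, coord b j (P.root k) * P.toLinearMap (P.root j) (rhoCheck b X) := by
    conv_lhs => rw [← sum_coord_smul b (P.root k)]
    simp [LinearMap.sum_apply]
  have hint : ∀ j : b.support, (∃ n : ℤ, P.toLinearMap (P.root j) (rhoCheck b X) = n) →
      q (coord b j (P.root k) * P.toLinearMap (P.root j) (rhoCheck b X)) = 0 := by
    rintro j ⟨n, hn⟩
    obtain ⟨m, hm⟩ := exists_coord_eq_int b k j
    exact (hq _).2 ⟨m * n, by rw [hm, hn, Int.cast_mul]⟩
  have hX : ∀ j ∈ X, q (coord b j (P.root k) * P.toLinearMap (P.root j) (rhoCheck b X)) = 0 :=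
    fun j hj ↦ hint j ⟨1, by rw [toLinearMap_simple_rhoCheck hj, Int.cast_one]⟩
  rw [← hq, hsum, map_sum]
  refine Finset.sum_involution (fun j _ ↦ τ j) (fun j _ ↦ ?_) (fun j _ h0 hj ↦ h0 ?_)
    (fun _ _ ↦ Finset.mem_univ _) fun j _ ↦ hS.involutive j
  · by_cases hj : j ∈ X
    · rw [hX j hj, hX _ ((hS.mem_iff j).2 hj), add_zero]
    · obtain ⟨m, hm⟩ := exists_coord_eq_int b k j
      obtain ⟨n, hn⟩ := exists_two_mul_rhoCheck_eq_int (X := X) (j : ι)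
      rw [← map_add, hk j hj, hτ, ← two_mul, hm, hq]
      exact ⟨m * n, by rw [Int.cast_mul, ← hn]; ring⟩
  · by_cases hjX : j ∈ X
    · exact hX j hjX
    · exact hint j (hS.integral j hjX hj)

/-- The sum `α + Θ α` is not a root. Such a root would be fixed by `Θ`, and then lie in the span of
`X`; by an element of `W_X`, which commutes with `Θ`, it can be moved to a simple root `α_j`,
`j ∈ X`. But then `2 ⟨α, ρ_X^∨⟩ = ⟨α_j, ρ_X^∨⟩ = 1`, whereas `⟨α, ρ_X^∨⟩` is an integer. -/
lemma root_add_theta_ne (k m : ι) : P.root k + Theta b X τ (P.root k) ≠ P.root m := by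
  have key : ∀ k m, IsNonneg b (P.root m) → P.root k + Theta b X τ (P.root k) ≠ P.root m := by
    intro k m hm h
    have hfix : Theta b X τ (P.root m) = P.root m := by
      rw [← h, map_add, hS.theta_theta, add_comm]
    refine positive_root_induction (p := fun v ↦ ∀ k, P.root k + Theta b X τ (P.root k) ≠ v)
      ?_ ?_ hm (hS.mem_leviSpan_of_theta_root hfix) k h
    · intro j hj k h
      obtain ⟨n, hn⟩ := hS.exists_rhoCheck_eq_int (k := k) fun i hi ↦ by
        have h1 := congrArg (coord b i) h
        rw [map_add, hS.coord_theta hi, coord_root_of_ne (ne_of_mem_of_not_mem hj hi)] at h1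
        linarith
      have h2 := toLinearMap_rhoCheck_of_permutes (X := X) (b := b)
        (f := LinearEquiv.ofInvolutive (Theta b X τ) hS.theta_theta) hS.theta_root
        (fun i hi ↦ ⟨i, hi, hS.theta_simple hi⟩) (P.root k)
      have h3 := toLinearMap_simple_rhoCheck hj
      rw [← h, map_add, LinearMap.add_apply, hn] at h3
      change P.toLinearMap (Theta b X τ (P.root k)) _ = _ at h2
      rw [h2, hn] at h3
      have h4 : n + n = 1 := by exact_mod_cast h3
      omega
    · intro m j hj h k hk
      refine h (P.reflectionPerm j k) ?_
      rw [P.root_reflectionPerm, hS.theta_reflection (hS.theta_simple hj), ← map_add, hk]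
  rcases isNonneg_or_neg b m with hm | hm
  · exact key k m hm
  · intro h
    refine key (P.reflectionPerm k k) (P.reflectionPerm m m) ?_ ?_
    · rwa [P.root_reflectionPerm, P.reflection_apply_self]
    · rw [P.root_reflectionPerm, P.root_reflectionPerm, P.reflection_apply_self,
        P.reflection_apply_self, map_neg, ← h, neg_add]

end IsSatakeDiagram

end Rho

/-! ### Reflections of `V₋₁` realised in the Weyl group -/

section Restriction

variable {ι V N : Type*} [Fintype ι] [AddCommGroup V] [Module ℝ V] [AddCommGroup N] [Module ℝ N]
  {P : RootPairing ι ℝ V N}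

/-- The orthogonal reflection `v ↦ v - 2 (v, γ) / (γ, γ) γ` of `V`. -/
noncomputable def reflAt (P : RootPairing ι ℝ V N) (γ v : V) : V :=
  v - (2 * normForm P v γ / normForm P γ γ) • γ

lemma reflAt_smul {a : ℝ} (ha : a ≠ 0) (γ v : V) : reflAt P (a • γ) v = reflAt P γ v := by
  unfold reflAt
  rw [map_smul, map_smul, map_smul, LinearMap.smul_apply, smul_smul, smul_eq_mul, smul_eq_mul,
    smul_eq_mul]
  congr 2
  by_cases h : normForm P γ γ = 0
  · simp [h]
  · field_simp

lemma reflAt_neg (γ v : V) : reflAt P (-γ) v = reflAt P γ v := by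
  rw [← neg_one_smul ℝ γ, reflAt_smul (neg_ne_zero.2 one_ne_zero)]

lemma reflection_eq_reflAt (k : ι) (v : V) : P.reflection k v = reflAt P (P.root k) v := by
  rw [P.reflection_apply, reflAt, ← coroot'_mul_normForm,
    mul_div_cancel_right₀ _ (normForm_root_pos P k).ne']

variable [P.IsRootSystem]

lemma reflAt_self {γ : V} (h : γ ≠ 0) : reflAt P γ γ = -γ := by
  rw [reflAt, mul_div_cancel_right₀ _ (normForm_pos P h).ne', two_smul]
  abel

variable {b : P.Base} {X : Set b.support} {τ : Equiv.Perm b.support}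

lemma map_tilde {f : V →ₗ[ℝ] V} (hf : ∀ v, Theta b X τ (f v) = f (Theta b X τ v)) (v : V) :
    f (tilde b X τ v) = tilde b X τ (f v) := by
  rw [tilde, tilde, map_smul, map_sub, hf]

lemma map_mem_Vneg {f : V →ₗ[ℝ] V} (hf : ∀ v, Theta b X τ (f v) = f (Theta b X τ v)) {v : V}
    (hv : v ∈ Vneg b X τ) : f v ∈ Vneg b X τ := by
  rw [mem_Vneg] at hv ⊢
  rw [hf, hv, map_neg]

lemma tilde_neg (v : V) : tilde b X τ (-v) = -tilde b X τ v := by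
  rw [tilde, tilde, map_neg, ← smul_neg]
  congr 1
  abel

/-- The vector `β̃` as a combination of the vectors `α̃_j`. -/
lemma tilde_eq_sum (v : V) :
    tilde b X τ v = ∑ j, coord b j v • tilde b X τ (P.root j) := by
  have h : ∀ v, tilde b X τ v =
      ((1 / 2 : ℝ) • (LinearMap.id - Theta b X τ) : V →ₗ[ℝ] V) v := fun _ ↦ rfl
  simp only [h]
  conv_lhs => rw [← sum_coord_smul b v]
  simp only [map_sum, map_smul]

variable (b X τ) in
lemma finite_WTilde : Finite (WTilde b X τ) := by
  have : Finite (weylGroup b) := finite_parabolic b Set.univ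
  exact Finite.of_injective _ (Subgroup.inclusion_injective (WTilde_le_weylGroup b X τ))

namespace IsSatakeDiagram

variable [P.IsCrystallographic] (hS : IsSatakeDiagram b X τ)
include hS

lemma tilde_of_mem_leviSpan {v : V} (hv : v ∈ leviSpan b X) : tilde b X τ v = 0 := by
  rw [tilde, hS.theta_of_mem_leviSpan hv, sub_self, smul_zero]

lemma coordPair_tilde {i : b.support} (hi : i ∉ X) (v : V) :
    coordPair b τ i (tilde b X τ v) = coordPair b τ i v := by
  have hi' : τ i ∉ X := fun h ↦ hi ((hS.mem_iff i).1 h)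
  have h : coordPair b τ i (Theta b X τ v) = -coordPair b τ i v := by
    rw [coordPair, LinearMap.add_apply, LinearMap.add_apply, hS.coord_theta hi,
      hS.coord_theta hi', hS.involutive]
    ring
  rw [tilde, map_smul, map_sub, h, smul_eq_mul]
  ring

lemma tilde_simple_ne_zero {i : b.support} (hi : i ∉ X) : tilde b X τ (P.root i) ≠ 0 := by
  intro h
  have h1 := coordPair_simple_pos (τ := τ) i
  rw [← hS.coordPair_tilde hi, h, map_zero] at h1
  exact h1.false

open scoped Classical in
lemma sum_coord_tilde (v : V) :
    ∑ j with j ∉ X, coord b j (tilde b X τ v) = ∑ j with j ∉ X, coord b j v := by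
  have h : ∑ j with j ∉ X, coord b (τ j) v = ∑ j with j ∉ X, coord b j v :=
    Finset.sum_equiv τ (fun j ↦ by simp [hS.mem_iff]) fun j _ ↦ rfl
  have h1 : ∀ j ∈ ({j | j ∉ X} : Finset b.support), coord b j (tilde b X τ v) =
      1 / 2 * (coord b j v + coord b (τ j) v) := by
    intro j hj
    rw [tilde, map_smul, map_sub, hS.coord_theta (by simpa using hj), sub_neg_eq_add, smul_eq_mul]
  rw [Finset.sum_congr rfl h1, ← Finset.mul_sum, Finset.sum_add_distrib, h]
  ring

variable [P.IsReduced]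

lemma parabolic_apply_of_mem_Vneg {w : V ≃ₗ[ℝ] V} (hw : w ∈ parabolic b X) {v : V}
    (hv : v ∈ Vneg b X τ) : w v = v := by
  induction hw using parabolic_induction with
  | one => rfl
  | mul j hj w _ ih =>
    have h1 := hS.normForm_theta v (P.root j)
    rw [(mem_Vneg b X τ).1 hv, hS.theta_simple hj, map_neg, LinearMap.neg_apply] at h1
    have h2 : normForm P v (P.root j) = 0 := by linarith
    rw [LinearEquiv.mul_apply, ih, reflection_eq_reflAt, reflAt, h2, mul_zero, zero_div, zero_smul,
      sub_zero]

lemma theta_parabolic {w : V ≃ₗ[ℝ] V} (hw : w ∈ parabolic b X) (v : V) :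
    Theta b X τ (w v) = w (Theta b X τ v) := by
  induction hw using parabolic_induction generalizing v with
  | one => rfl
  | mul j hj w _ ih =>
    rw [LinearEquiv.mul_apply, LinearEquiv.mul_apply, hS.theta_reflection (hS.theta_simple hj), ih]

lemma tilde_parabolic {w : V ≃ₗ[ℝ] V} (hw : w ∈ parabolic b X) (v : V) :
    tilde b X τ (w v) = tilde b X τ v := by
  rw [← hS.parabolic_apply_of_mem_Vneg hw (tilde_mem_Vneg b X τ hS.theta_theta v)]
  exact (map_tilde (f := w.toLinearMap) (hS.theta_parabolic hw) v).symm

lemma tilde_simple_eq (i : b.support) :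
    tilde b X τ (P.root (τ i)) = tilde b X τ (P.root i) := by
  rw [← hS.tilde_parabolic (isLongest_longest b X).1 (P.root (τ i))]
  have h : longest b X (P.root (τ i)) = -Theta b X τ (P.root i) := by
    rw [theta_apply, permAut_root, neg_neg]
  rw [h, tilde, tilde, map_neg, hS.theta_theta]
  congr 1
  abel

lemma theta_reflection_of_neg {k m : ι} (h : Theta b X τ (P.root k) = -P.root m) (v : V) :
    Theta b X τ (P.reflection k v) = P.reflection m (Theta b X τ v) := by
  have h1 : Theta b X τ (P.root k) = P.root (P.reflectionPerm m m) := by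
    rw [h, P.root_reflectionPerm, P.reflection_apply_self]
  rw [hS.theta_reflection h1, P.reflection_reflectionPerm, ← sq, P.reflection_sq, one_mul]

lemma normForm_tilde {v : V} (hv : v ∈ Vneg b X τ) (β : V) :
    normForm P v (tilde b X τ β) = normForm P v β := by
  have h1 := hS.normForm_theta v β
  rw [(mem_Vneg b X τ).1 hv, map_neg, LinearMap.neg_apply] at h1
  rw [tilde, map_smul, map_sub, smul_eq_mul]
  linarith

/-- For every root `α` with `α̃ ≠ 0`, the reflection of `V₋₁` at `α̃` is the restriction of an element
of the Weyl group that commutes with `Θ`. With `σ = -Θ`, the difference `σ α - α` is not a root, so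
that either `σ α = α`, or `α` and `σ α` are orthogonal, or `α + σ α = 2 α̃` is a root. The element is
`s_α`, or `s_α s_{σ α}`, or the reflection at `2 α̃`, respectively. -/
lemma exists_reflAt (k : ι) (h0 : tilde b X τ (P.root k) ≠ 0) :
    ∃ r : V ≃ₗ[ℝ] V,
      (∀ J, P.root k ∈ leviSpan b J → Theta b X τ (P.root k) ∈ leviSpan b J →
        r ∈ parabolic b J) ∧
      (∀ v, Theta b X τ (r v) = r (Theta b X τ v)) ∧
      ∀ v ∈ Vneg b X τ, r v = reflAt P (tilde b X τ (P.root k)) v := by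
  obtain ⟨m, hm⟩ := hS.theta_root k
  obtain ⟨n, hn⟩ : ∃ n, Theta b X τ (P.root k) = -P.root n :=
    ⟨P.reflectionPerm m m, by rw [P.root_reflectionPerm, P.reflection_apply_self, neg_neg, hm]⟩
  have hn' : Theta b X τ (P.root n) = -P.root k := by
    rw [← neg_neg (P.root n), ← hn, map_neg, hS.theta_theta]
  have ht : P.root k + P.root n = (2 : ℝ) • tilde b X τ (P.root k) := by
    rw [tilde, hn, smul_smul, sub_neg_eq_add]
    norm_num
  by_cases hkn : k = n
  · subst hkn
    have h1 : P.root k = tilde b X τ (P.root k) := by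
      rw [← two_smul ℝ (P.root k)] at ht
      exact (smul_right_injective V (two_ne_zero (α := ℝ))) ht
    refine ⟨P.reflection k, fun J hJ _ ↦ reflection_mem_parabolic_of_mem_leviSpan hJ,
      hS.theta_reflection_of_neg hn, fun v _ ↦ ?_⟩
    rw [← h1, reflection_eq_reflAt]
  · rcases lt_trichotomy (P.pairingIn ℤ k n) 0 with hneg | hzero | hpos
    · obtain ⟨l, hl⟩ := P.root_add_root_mem_of_pairingIn_neg hneg fun h ↦ h0 (by
        rw [show P.root k + P.root n = 0 by rw [h, neg_add_cancel]] at ht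
        exact (smul_eq_zero.1 ht.symm).resolve_left two_ne_zero)
      refine ⟨P.reflection l, fun J hJ hJ' ↦ reflection_mem_parabolic_of_mem_leviSpan ?_,
        hS.theta_reflection_of_neg ?_, fun v _ ↦ ?_⟩
      · rw [hl]
        rw [hn] at hJ'
        exact add_mem hJ (neg_mem_iff.1 hJ')
      · rw [hl, map_add, hn, hn', neg_add, add_comm]
      · rw [reflection_eq_reflAt, hl, ht, reflAt_smul two_ne_zero]
    · have hp : P.pairing k n = 0 := by
        rw [← P.algebraMap_pairingIn ℤ, hzero, map_zero]
      have hp' : P.pairing n k = 0 := P.pairing_eq_zero_iff'.1 hp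
      have hcomm : P.reflection k * P.reflection n = P.reflection n * P.reflection k :=
        P.isOrthogonal_comm k n ⟨hp, hp'⟩
      refine ⟨P.reflection k * P.reflection n, fun J hJ hJ' ↦ ?_, fun v ↦ ?_, fun v hv ↦ ?_⟩
      · rw [hn] at hJ'
        exact mul_mem (reflection_mem_parabolic_of_mem_leviSpan hJ)
          (reflection_mem_parabolic_of_mem_leviSpan (neg_mem_iff.1 hJ'))
      · rw [hcomm, LinearEquiv.mul_apply, hS.theta_reflection_of_neg hn',
          hS.theta_reflection_of_neg hn, ← LinearEquiv.mul_apply, hcomm]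
      · set t := tilde b X τ (P.root k) with htdef
        set q := normForm P (P.root k) (P.root k) with hq
        have hq0 : 0 < q := normForm_root_pos P k
        have hqn : normForm P (P.root n) (P.root n) = q := by
          rw [hq, ← hS.normForm_theta, hn', map_neg, map_neg, LinearMap.neg_apply, neg_neg]
        have hvk : normForm P v (P.root k) = normForm P v t := (hS.normForm_tilde hv _).symm
        have hvn : normForm P v (P.root n) = normForm P v t := by
          rw [← hvk, ← hS.normForm_theta v (P.root k), (mem_Vneg b X τ).1 hv, hn, map_neg, map_neg,
            LinearMap.neg_apply, neg_neg]
        have hkn0 : normForm P (P.root k) (P.root n) = 0 := by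
          have := coroot'_mul_normForm P n (P.root k)
          rw [P.root_coroot'_eq_pairing, hp, zero_mul] at this
          linarith
        have htt : normForm P t t = q / 2 := by
          have h1 := hS.normForm_tilde (tilde_mem_Vneg b X τ hS.theta_theta (P.root k)) (P.root k)
          have h2 := congrArg (normForm P (P.root k)) ht
          rw [map_add, hkn0, map_smul, smul_eq_mul, ← hq, normForm_symm] at h2
          rw [h1, ← htdef]
          linarith
        have h1 : P.reflection n v = v - (2 * normForm P v t / q) • P.root n := by
          rw [reflection_eq_reflAt, reflAt, hqn, hvn]
        have h2 : P.reflection k v = v - (2 * normForm P v t / q) • P.root k := by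
          rw [reflection_eq_reflAt, reflAt, hvk]
        have h3 : P.reflection k (P.root n) = P.root n := by
          rw [P.reflection_apply_root, hp', zero_smul, sub_zero]
        rw [LinearEquiv.mul_apply, h1, map_sub, map_smul, h2, h3, sub_sub, ← smul_add, ht,
          smul_smul, reflAt, htt]
        congr 2
        field_simp
    · obtain ⟨l, hl⟩ := P.root_sub_root_mem_of_pairingIn_pos hpos hkn
      refine absurd ?_ (hS.root_add_theta_ne k l)
      rw [hn, ← sub_eq_add_neg, hl]

/-! ### The elements `s̃_i` -/

/-- The element `s̃_i` differs from the element of `W_K`, `K = {i, τ i} ∪ X`, that realises the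
reflection at `α̃_i` by an element of `W_X`: indeed both that element and `w_K` send all positive
roots in the span of `K`, but not of `X`, to negative ones. -/
lemma exists_sTilde_eq {i : b.support} (hi : i ∉ X) :
    ∃ r u : V ≃ₗ[ℝ] V, sTilde b X τ i = r * u ∧ u ∈ parabolic b X ∧
      (∀ v, Theta b X τ (r v) = r (Theta b X τ v)) ∧
      ∀ v ∈ Vneg b X τ, r v = reflAt P (tilde b X τ (P.root i)) v := by
  obtain ⟨r, hrJ, hrΘ, hr⟩ := hS.exists_reflAt i (hS.tilde_simple_ne_zero hi)
  set K : Set b.support := {i, τ i} ∪ X with hK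
  have hXK : X ⊆ K := Set.subset_union_right
  have hrK : r ∈ parabolic b K := by
    refine hrJ K (simple_mem_leviSpan b (by simp [hK])) ?_
    rw [theta_apply, permAut_root]
    exact neg_mem (parabolic_mem_leviSpan (parabolic_mono b hXK (isLongest_longest b X).1)
      (simple_mem_leviSpan b (by simp [hK])))
  have hwK := (isLongest_longest b K).1
  have hu : (longest b K)⁻¹ * r ∈ parabolic b X := by
    refine mem_parabolic_of_isNonneg (mul_mem (inv_mem hwK) hrK) fun u hu k hk hkX ↦ ?_
    have hkt : tilde b X τ (P.root k) = tilde b X τ (P.root i) := by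
      rcases hk with (rfl | rfl) | hk
      · rfl
      · exact hS.tilde_simple_eq i
      · exact absurd hk hkX
    have hruK : r * u ∈ parabolic b K := mul_mem hrK (parabolic_mono b hXK hu)
    obtain ⟨m, hm⟩ := parabolic_apply_root hruK k
    have hmK : P.root m ∈ leviSpan b K :=
      hm ▸ parabolic_mem_leviSpan hruK (simple_mem_leviSpan b hk)
    have hmt : tilde b X τ (P.root m) = -tilde b X τ (P.root i) := by
      rw [← hm, LinearEquiv.mul_apply, ← LinearEquiv.coe_coe r,
        ← map_tilde (f := r.toLinearMap) hrΘ, hS.tilde_parabolic hu, hkt, LinearEquiv.coe_coe,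
        hr _ (tilde_mem_Vneg b X τ hS.theta_theta _), reflAt_self (hS.tilde_simple_ne_zero hi)]
    -- `α̃_m = -α̃_i`, so the coefficients of `α_m` at `α_i` and `α_{τ i}` have negative sum.
    have hmneg : ¬ IsNonneg b (P.root m) := by
      intro h
      have h1 : 0 ≤ coordPair b τ i (P.root m) := add_nonneg (h i) (h (τ i))
      rw [← hS.coordPair_tilde hi, hmt, map_neg, hS.coordPair_tilde hi] at h1
      linarith [coordPair_simple_pos (τ := τ) i]
    obtain ⟨p, hp⟩ := parabolic_apply_root (inv_mem hwK) m
    have hpm : longest b K (P.root p) = P.root m := by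
      rw [← hp, ← LinearEquiv.mul_apply, mul_inv_cancel, LinearEquiv.coe_one, id]
    have heq : ((longest b K)⁻¹ * r) (u (P.root k)) = P.root p := by
      rw [LinearEquiv.mul_apply, ← LinearEquiv.mul_apply r, hm, hp]
    rw [heq]
    refine (isNonneg_or_neg b p).resolve_right fun hneg ↦ hmneg ?_
    have h1 := IsNonneg.map (J := K) (f := -(longest b K).toLinearMap)
      (fun j hj ↦ longest_apply_simple K hj) hneg
      (neg_mem (hp ▸ parabolic_mem_leviSpan (inv_mem hwK) hmK))
    rwa [LinearMap.neg_apply, map_neg, neg_neg, LinearEquiv.coe_coe, hpm] at h1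
  refine ⟨r, ((longest b K)⁻¹ * r)⁻¹ * (longest b X)⁻¹, ?_,
    mul_mem (inv_mem hu) (inv_mem (isLongest_longest b X).1), hrΘ, hr⟩
  rw [sTilde, ← hK]
  group

lemma sTilde_apply {i : b.support} (hi : i ∉ X) {v : V} (hv : v ∈ Vneg b X τ) :
    sTilde b X τ i v = reflAt P (tilde b X τ (P.root i)) v := by
  obtain ⟨r, u, h, hu, -, hr⟩ := hS.exists_sTilde_eq hi
  rw [h, LinearEquiv.mul_apply, hS.parabolic_apply_of_mem_Vneg hu hv, hr v hv]

lemma theta_sTilde {i : b.support} (hi : i ∉ X) (v : V) :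
    Theta b X τ (sTilde b X τ i v) = sTilde b X τ i (Theta b X τ v) := by
  obtain ⟨r, u, h, hu, hr, -⟩ := hS.exists_sTilde_eq hi
  rw [h, LinearEquiv.mul_apply, LinearEquiv.mul_apply, hr, hS.theta_parabolic hu]

lemma sTilde_simple (i : b.support) {j : b.support} (hj : j ∈ X) :
    IsNonneg b (sTilde b X τ i (P.root j)) := by
  have h : (longest b X)⁻¹ (P.root j) = -P.root (τ j) := by
    rw [LinearEquiv.coe_inv, LinearEquiv.symm_apply_eq, map_neg,
      hS.longest_simple ((hS.mem_iff j).2 hj), neg_neg, hS.involutive]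
  rw [sTilde, LinearEquiv.mul_apply, h, map_neg]
  exact longest_apply_simple _ (Set.mem_union_right _ ((hS.mem_iff j).2 hj))

/-! ### The action of `W̃` on `V₋₁` -/

lemma theta_WTilde {w : V ≃ₗ[ℝ] V} (hw : w ∈ WTilde b X τ) (v : V) :
    Theta b X τ (w v) = w (Theta b X τ v) := by
  induction hw using Subgroup.closure_induction generalizing v with
  | mem x hx =>
    obtain ⟨i, hi, rfl⟩ := hx
    exact hS.theta_sTilde hi v
  | one => rfl
  | mul x y _ _ hx hy => rw [LinearEquiv.mul_apply, LinearEquiv.mul_apply, hx, hy]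
  | inv x _ hx =>
    apply x.injective
    rw [← hx, ← LinearEquiv.mul_apply, ← LinearEquiv.mul_apply, mul_inv_cancel]
    rfl

/-- The elements of `W̃` preserve the set of positive roots in the span of `X`, that is, of positive
roots fixed by `Θ`. -/
lemma isNonneg_WTilde_iff {w : V ≃ₗ[ℝ] V} (hw : w ∈ WTilde b X τ) {k : ι}
    (hk : Theta b X τ (P.root k) = P.root k) :
    IsNonneg b (w (P.root k)) ↔ IsNonneg b (P.root k) := by
  induction hw using Subgroup.closure_induction generalizing k with
  | mem x hx =>
    obtain ⟨i, -, rfl⟩ := hx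
    have hkX := hS.mem_leviSpan_of_theta_root hk
    have key : ∀ v ∈ leviSpan b X, IsNonneg b v → IsNonneg b (sTilde b X τ i v) :=
      fun v hv hv' ↦ IsNonneg.map (f := (sTilde b X τ i).toLinearMap)
        (fun j hj ↦ hS.sTilde_simple i hj) hv' hv
    refine ⟨fun h ↦ (isNonneg_or_neg b k).resolve_right fun h' ↦ ?_, key _ hkX⟩
    have h1 := key _ (neg_mem hkX) h'
    rw [map_neg] at h1
    refine P.ne_zero k ((sTilde b X τ i).injective ?_)
    rw [eq_zero_of_isNonneg_neg h h1, map_zero]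
  | one => rfl
  | mul x y _ hy ihx ihy =>
    obtain ⟨m, hm⟩ := parabolic_apply_root (WTilde_le_weylGroup b X τ hy) k
    rw [LinearEquiv.mul_apply, ← ihy hk, hm]
    exact ihx (by rw [← hm, hS.theta_WTilde hy, hk])
  | inv x hx ih =>
    obtain ⟨m, hm⟩ := parabolic_apply_root (WTilde_le_weylGroup b X τ (inv_mem hx)) k
    have h1 : x (P.root m) = P.root k := by
      rw [← hm, ← LinearEquiv.mul_apply, mul_inv_cancel, LinearEquiv.coe_one, id]
    rw [hm, ← ih (k := m) (by rw [← hm, hS.theta_WTilde (inv_mem hx), hk]), h1]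

/-- The group `W̃` acts faithfully on `V₋₁`: an element acting trivially sends all simple roots to
positive roots. -/
lemma eq_one_of_WTilde {w : V ≃ₗ[ℝ] V} (hw : w ∈ WTilde b X τ)
    (h : ∀ v ∈ Vneg b X τ, w v = v) : w = 1 := by
  have hW := WTilde_le_weylGroup b X τ hw
  refine eq_one_of_isNonneg hW fun j _ ↦ ?_
  by_cases hj : j ∈ X
  · exact (hS.isNonneg_WTilde_iff hw (hS.theta_simple hj)).2 (isNonneg_simple b j)
  · obtain ⟨m, hm⟩ := parabolic_apply_root hW j
    rw [hm]
    refine isNonneg_of_coordPair_pos (τ := τ) (i := j) ?_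
    have h1 := map_tilde (f := w.toLinearMap) (hS.theta_WTilde hw) (P.root j)
    rw [LinearEquiv.coe_coe, h _ (tilde_mem_Vneg b X τ hS.theta_theta _), hm] at h1
    rw [← hS.coordPair_tilde hj, ← h1, hS.coordPair_tilde hj]
    exact coordPair_simple_pos j

/-- Every reflection at a restricted root is the restriction of an element of `W̃`. This is proved by
descent: a positive root `β` with `β̃ ≠ 0` has, for some `i ∉ X`, a positive coefficient at `α_i` and
`(β̃, α̃_i) > 0`. Then either `s̃_i β` is a positive root with a smaller sum of coefficients outside
`X`, or `β̃` is a multiple of `α̃_i`. -/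
lemma exists_WTilde_reflAt (k : ι) (h0 : tilde b X τ (P.root k) ≠ 0) :
    ∃ w ∈ WTilde b X τ, ∀ v ∈ Vneg b X τ, w v = reflAt P (tilde b X τ (P.root k)) v := by
  classical
  have key : ∀ k, IsNonneg b (P.root k) → tilde b X τ (P.root k) ≠ 0 →
      ∃ w ∈ WTilde b X τ, ∀ v ∈ Vneg b X τ, w v = reflAt P (tilde b X τ (P.root k)) v := by
    by_contra hcon
    push Not at hcon
    obtain ⟨k, ⟨hk, hk0, hkw⟩, hmin⟩ := Set.exists_min_image
      {k | IsNonneg b (P.root k) ∧ tilde b X τ (P.root k) ≠ 0 ∧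
        ∀ w ∈ WTilde b X τ, ∃ v ∈ Vneg b X τ, w v ≠ reflAt P (tilde b X τ (P.root k)) v}
      (fun k ↦ ∑ j with j ∉ X, coord b j (P.root k)) (Set.toFinite _) hcon
    set γ := tilde b X τ (P.root k) with hγ
    obtain ⟨i, hi1, hi2⟩ : ∃ i : b.support, 0 < coord b i (P.root k) ∧
        0 < normForm P γ (tilde b X τ (P.root i)) := by
      by_contra! h
      refine (normForm_pos P hk0).not_ge ?_
      nth_rw 2 [hγ]
      rw [tilde_eq_sum (P.root k), map_sum]
      refine Finset.sum_nonpos fun j _ ↦ ?_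
      rw [map_smul, smul_eq_mul]
      rcases (hk j).eq_or_lt with h1 | h1
      · rw [← h1, zero_mul]
      · exact mul_nonpos_of_nonneg_of_nonpos h1.le (h j h1)
    have hi : i ∉ X := by
      intro hi
      rw [hS.tilde_of_mem_leviSpan (simple_mem_leviSpan b hi), map_zero] at hi2
      exact hi2.false
    set t := tilde b X τ (P.root i) with ht
    set s := sTilde b X τ i with hs
    have hsW : s ∈ WTilde b X τ := sTilde_mem_WTilde b X τ hi
    have hsP := WTilde_le_weylGroup b X τ hsW
    have hγV : γ ∈ Vneg b X τ := tilde_mem_Vneg b X τ hS.theta_theta _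
    obtain ⟨m, hm⟩ := parabolic_apply_root hsP k
    have hmγ : tilde b X τ (P.root m) = s γ := by
      rw [← hm]
      exact (map_tilde (f := s.toLinearMap) (hS.theta_WTilde hsW) _).symm
    have hmγ' : s γ = γ - (2 * normForm P γ t / normForm P t t) • t := hS.sTilde_apply hi hγV
    rcases isNonneg_or_neg b m with hmpos | hmneg
    · have hlt : ∑ j with j ∉ X, coord b j (P.root m) < ∑ j with j ∉ X, coord b j (P.root k) := by
        have h1 : ∑ j with j ∉ X, coord b j t = 1 := by
          rw [ht, hS.sum_coord_tilde, Finset.sum_eq_single_of_mem i (by simpa using hi)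
            fun j _ hj ↦ coord_root_of_ne hj.symm, coord_root_self]
        have h2 : 0 < 2 * normForm P γ t / normForm P t t :=
          div_pos (mul_pos two_pos hi2) (normForm_pos P (hS.tilde_simple_ne_zero hi))
        rw [← hS.sum_coord_tilde (P.root m), ← hS.sum_coord_tilde (P.root k), hmγ, hmγ', ← hγ]
        simp only [map_sub, map_smul, smul_eq_mul, Finset.sum_sub_distrib, ← Finset.mul_sum]
        rw [h1]
        linarith
      have hm0 : tilde b X τ (P.root m) ≠ 0 := by
        rw [hmγ]
        exact fun h ↦ hk0 (s.injective (h.trans (map_zero s).symm))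
      obtain ⟨w, hw, hwv⟩ : ∃ w ∈ WTilde b X τ, ∀ v ∈ Vneg b X τ,
          w v = reflAt P (tilde b X τ (P.root m)) v := by
        by_contra! h
        exact (hmin m ⟨hmpos, hm0, h⟩).not_gt hlt
      obtain ⟨v, hv, hne⟩ := hkw (s⁻¹ * w * s) (mul_mem (mul_mem (inv_mem hsW) hw) hsW)
      refine hne (s.injective ?_)
      have h1 : s ((s⁻¹ * w * s) v) = w (s v) := by
        rw [← LinearEquiv.mul_apply, ← LinearEquiv.mul_apply]
        congr 1
        group
      have hsv : s v ∈ Vneg b X τ :=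
        map_mem_Vneg (f := s.toLinearMap) (hS.theta_WTilde hsW) hv
      rw [h1, hwv _ hsv, hmγ, reflAt,
        reflAt, normForm_parabolic hsP, normForm_parabolic hsP, map_sub, map_smul]
    · -- Outside `{i, τ i} ∪ X` the coefficients of `β` and `s̃_i β` agree, hence vanish.
      have hspan : γ ∈ Submodule.span ℝ {t} := by
        rw [hγ, tilde_eq_sum]
        refine sum_mem fun j _ ↦ ?_
        by_cases hj : j ∈ ({i, τ i} ∪ X : Set b.support)
        · refine Submodule.smul_mem _ _ ?_
          rcases hj with (rfl | rfl) | hj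
          · exact Submodule.mem_span_singleton_self t
          · rw [hS.tilde_simple_eq]
            exact Submodule.mem_span_singleton_self t
          · rw [hS.tilde_of_mem_leviSpan (simple_mem_leviSpan b hj)]
            exact zero_mem _
        · have hsK : s ∈ parabolic b ({i, τ i} ∪ X) := mul_mem (isLongest_longest b _).1
            (inv_mem (parabolic_mono b Set.subset_union_right (isLongest_longest b X).1))
          have h1 := parabolic_apply_sub_mem hsK (P.root k) j hj
          have h2 := hmneg j
          rw [map_sub, hm] at h1
          rw [map_neg] at h2
          have h3 : coord b j (P.root k) = 0 := by linarith [hk j]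
          rw [h3, zero_smul]
          exact zero_mem _
      obtain ⟨a, ha⟩ := Submodule.mem_span_singleton.1 hspan
      have ha0 : a ≠ 0 := by
        rintro rfl
        rw [zero_smul] at ha
        exact hk0 ha.symm
      obtain ⟨v, hv, hne⟩ := hkw s hsW
      exact hne (by rw [← ha, reflAt_smul ha0, hs, hS.sTilde_apply hi hv])
  rcases isNonneg_or_neg b k with h | h
  · exact key k h h0
  · have h1 : P.root (P.reflectionPerm k k) = -P.root k := by
      rw [P.root_reflectionPerm, P.reflection_apply_self]
    have h2 := key (P.reflectionPerm k k) (h1 ▸ h) (by rwa [h1, tilde_neg, neg_ne_zero])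
    simpa only [h1, tilde_neg, reflAt_neg] using h2

/-- The restriction of the action of `W̃` to `V₋₁`. -/
noncomputable def restrictHom : WTilde b X τ →* (Vneg b X τ ≃ₗ[ℝ] Vneg b X τ) where
  toFun w :=
    { (w : V ≃ₗ[ℝ] V).toLinearMap.restrict
        fun _ ↦ map_mem_Vneg (f := (w : V ≃ₗ[ℝ] V).toLinearMap) (hS.theta_WTilde w.2) with
      invFun := fun v ↦ ⟨(w⁻¹ : WTilde b X τ).1 v,
        map_mem_Vneg (f := (w⁻¹ : WTilde b X τ).1.toLinearMap) (hS.theta_WTilde w⁻¹.2) v.2⟩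
      left_inv := fun v ↦ Subtype.ext ((w : V ≃ₗ[ℝ] V).symm_apply_apply v)
      right_inv := fun v ↦ Subtype.ext ((w : V ≃ₗ[ℝ] V).apply_symm_apply v) }
  map_one' := rfl
  map_mul' _ _ := rfl

lemma restrictHom_apply (w : WTilde b X τ) (v : Vneg b X τ) :
    (hS.restrictHom w v : V) = (w : V ≃ₗ[ℝ] V) v := rfl

lemma restrictHom_injective : Function.Injective hS.restrictHom := by
  rw [injective_iff_map_eq_one]
  intro w hw
  refine Subtype.ext (hS.eq_one_of_WTilde w.2 fun v hv ↦ ?_)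
  rw [← hS.restrictHom_apply w ⟨v, hv⟩, hw]
  rfl

lemma tilde_simple_mem_restrictedRoots {i : b.support} (hi : i ∉ X) :
    tilde b X τ (P.root i) ∈ restrictedRoots b X τ :=
  (mem_restrictedRoots_iff b X τ hS.theta_theta).2 ⟨hS.tilde_simple_ne_zero hi, i, rfl⟩

lemma restrictHom_sTilde {i : b.support} (hi : i ∉ X) :
    hS.restrictHom ⟨sTilde b X τ i, sTilde_mem_WTilde b X τ hi⟩ =
      restrictedReflection b X τ ⟨_, hS.tilde_simple_mem_restrictedRoots hi⟩ :=
  LinearEquiv.ext fun v ↦ Subtype.ext (hS.sTilde_apply hi v.2)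

lemma range_restrictHom : hS.restrictHom.range = restrictedWeylGroup b X τ := by
  apply le_antisymm
  · rintro _ ⟨⟨w, hw⟩, rfl⟩
    induction hw using Subgroup.closure_induction with
    | mem x hx =>
      obtain ⟨i, hi, rfl⟩ := hx
      rw [hS.restrictHom_sTilde hi]
      exact Subgroup.subset_closure ⟨_, rfl⟩
    | one => exact one_mem _
    | mul x y hx hy ihx ihy => exact mul_mem ihx ihy
    | inv x hx ih => exact inv_mem ih
  · rw [restrictedWeylGroup, Subgroup.closure_le]
    rintro _ ⟨⟨γ, hγ⟩, rfl⟩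
    obtain ⟨h0, k, rfl⟩ := (mem_restrictedRoots_iff b X τ hS.theta_theta).1 hγ
    obtain ⟨w, hw, h⟩ := hS.exists_WTilde_reflAt k h0
    exact ⟨⟨w, hw⟩, LinearEquiv.ext fun v ↦ Subtype.ext (h v v.2)⟩

end IsSatakeDiagram

end Restriction

end RestrictedWeyl

theorem mainTheorem6 {ι V N : Type*} [Fintype ι] [AddCommGroup V] [Module ℝ V]
    [AddCommGroup N] [Module ℝ N] (P : RootPairing ι ℝ V N) [P.IsRootSystem]
    [P.IsCrystallographic] [P.IsReduced] (b : P.Base) (X : Set b.support)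
    (τ : Equiv.Perm b.support) (hXτ : RestrictedWeyl.IsSatakeDiagram b X τ) :
    Finite (RestrictedWeyl.restrictedWeylGroup b X τ) ∧
    ∃ ρ : RestrictedWeyl.WTilde b X τ ≃* RestrictedWeyl.restrictedWeylGroup b X τ,
      (∀ (w : RestrictedWeyl.WTilde b X τ) (v : RestrictedWeyl.Vneg b X τ),
        ((ρ w : RestrictedWeyl.Vneg b X τ ≃ₗ[ℝ] RestrictedWeyl.Vneg b X τ) v : V) =
          (w : V ≃ₗ[ℝ] V) (v : V)) ∧
      ∀ (i : b.support) (hi : i ∉ X),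
        ∃ h : RestrictedWeyl.tilde b X τ (P.root i) ∈ RestrictedWeyl.restrictedRoots b X τ,
          (ρ ⟨RestrictedWeyl.sTilde b X τ i, RestrictedWeyl.sTilde_mem_WTilde b X τ hi⟩ :
              RestrictedWeyl.Vneg b X τ ≃ₗ[ℝ] RestrictedWeyl.Vneg b X τ) =
            RestrictedWeyl.restrictedReflection b X τ
              ⟨RestrictedWeyl.tilde b X τ (P.root i), h⟩ := by
  let ρ := (MonoidHom.ofInjective hXτ.restrictHom_injective).trans
    (MulEquiv.subgroupCongr hXτ.range_restrictHom)
  have hfin := RestrictedWeyl.finite_WTilde b X τ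
  exact ⟨Finite.of_equiv _ ρ.toEquiv, ρ, hXτ.restrictHom_apply, fun i hi ↦
    ⟨hXτ.tilde_simple_mem_restrictedRoots hi, hXτ.restrictHom_sTilde hi⟩⟩
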